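/- **Model.** Fix sets of identifiers, roles, function symbols (with an involution $f\mapsto f^{-1}$ for inverse long-term keys), labels, agents (some of them trusted), intruder-generated atoms, and an infinite set of run identifiers. Role terms are built from identifiers, roles, function applications $f(x_1,\dots,x_n)$, pairs $(x,y)$ and encryptions $\{x\}_y$. Run terms are built in the same way from agents and *nonces*, a nonce being either $c^{\sharp rid}$ ($c$ an identifier, $rid$ a run identifier) or an intruder-generated atom; $f(\vec t)^{-1}=f^{-1}(\vec t)$, and every other run term is its own inverse. A role specification of role $r$ is a list of events of $r$, namely $\mathsf{create}_\ell(r)$ first, $\mathsf{end}_\ell(r)$ last, and in between events $\mathsf{send}_\ell(r,r',m)$, $\mathsf{read}_\ell(r',r,m)$ and $\mathsf{claim}_\ell(r,cl[,m])$, with a partial typing of identifiers as constant, parameter or variable that is defined on all identifiers occurring in the list. A protocol is a partial map from roles to role specifications in which labels are unique, except that corresponding send and read events share one; in a protocol set no label is used in two protocols. An instantiation is $inst=(rid,\rho,\sigma)$ with $\rho$ a partial map from roles to agents and $\sigma$ a partial map from identifiers to nonces; it maps (where defined) $r$ to $\rho(r)$, a constant $c$ to $c^{\sharp rid}$, a variable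 or parameter $x$ to $\sigma(x)$, and commutes with the term constructors. Fix the initial intruder knowledge $K_0$: a set of run terms that is closed (under pairing, projection, encryption $u,v\mapsto\{u\}_v$, and decryption $\{u\}_v,v^{-1}\mapsto u$), contains all intruder-generated atoms, and in which no $c^{\sharp rid}$ occurs. The traces $Tr(\Pi)$ of a protocol set $\Pi$ are the finite sequences of run events $(inst,ev)$ executable from the state with knowledge $K_0$ and no runs: a run of role $r$ of $P\in\Pi$ is created with a fresh run identifier, $\mathrm{dom}\,\rho=\mathrm{dom}\,P$ and $\sigma$ an arbitrary nonce assignment with domain exactly the parameters of $P(r)$, and then executes its events in order; a send of $m$ needs $inst(m)$ to be defined and replaces the knowledge $K$ by the closure of $K\cup\{inst(m)\}$; a read of $m$ extends $\sigma$ exactly to the variables of $m$, so that $inst(m)$ is in the knowledge; claim and end events can always be executed. **Claims.** A protocol set $\Pi$ satisfies the claim with label $\ell$, $\Pi\models\ell$, if for every $\alpha\in Tr(\Pi)$ and every event $(inst,\mathsf{claim}_\ell(r,cl,m))$ in $\alpha$, the property of $cl$ holds or some agent in the image of $\rho$ is untrusted. The property of *session* is the conjunction of (i)–(iii), that of *weak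 session* the conjunction of (i) and (ii): (i) *secret*: $inst(m)$ is not in the intruder knowledge after $\alpha$; (ii) *session-unique*: there are no two distinct positions in $\alpha$ that carry claim events with label $\ell$ and role $r$ and whose instantiations both map $m$ to $inst(m)$; (iii) *data-agree*: if $\ell$ belongs to the protocol $P$, there are a map $\kappa$ from $\mathrm{dom}\,P$ to run identifiers and a $\rho$ such that for every $r'\in\mathrm{dom}\,P$ the trace $\alpha$ contains a create event for role $r'$ of $P$ with run identifier $\kappa(r')$ and role assignment $\rho$, and an event of the run $\kappa(r')$ whose instantiation maps $m$ to the defined value $inst(m)$. In (i)–(iii) an instantiation is applied in the context of the role specification of its own event. **Composition and input.** $P$ *establishes* $c$ if in every trace of every protocol set containing $P$, every end event of $P$ has an instantiation defined at $c$. Let $\mathrm{dom}\,P=\mathrm{dom}\,Q$, let $P$ and $Q$ have no identifier in common, let $P$ establish $c$ and let $d$ be a parameter in all roles of $Q$. The *chaining composition* $P\cdot^{c,d}Q$ maps $r$ to the concatenation of $P(r)$ without its end event and $Q(r)[c/d]$ without its create event ($d$ replaced by $c$ in events and typing; the typing of $P(r)$ takes precedence). Its events are relabelled by a map of labels that is injective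 on the labels of $P$ and $Q$; $\ell'$ denotes the image of $\ell$. Let $\chi_{IO!}(\alpha)$ say: for every create event $(inst_i,\mathsf{create}(r))$ of $Q$ in $\alpha$, if $A$ is the set of positions $j$ of create events of $Q$ of the same role $r$ with $inst_j(d)=inst_i(d)$ and the same $\rho$, and $B$ the set of positions $j$ of end events of $P$ of role $r$ with $inst_j(c)=inst_i(d)$ and the same $\rho$, then there is an injective $f:A\to B$ with $f(j)<j$ for all $j\in A$. Write $\{P^{\to c},Q^{c\to! d}\}\cup\Pi\models\ell$ for satisfaction of $\ell$ by $\{P,Q\}\cup\Pi$ with $\alpha$ ranging only over the traces with $\chi_{IO!}(\alpha)$. **Statement.** Let $P,Q$ be protocols such that $P$ establishes $c$, $d$ is a parameter in all roles of $Q$, and $P\cdot^{c,d}Q$ is defined. Let $\Pi$ be a set of protocols with $P,Q\notin\Pi$, such that $\{P,Q\}\cup\Pi$ and $\{P\cdot^{c,d}Q\}\cup\Pi$ are protocol sets. Let $\ell$ be the label of a session claim event, or of a weak session claim event, in $P$ or $Q$, and $\ell'$ the corresponding label in $P\cdot^{c,d}Q$. Then $$\{P^{\to c},\,Q^{c\to!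 d}\}\cup\Pi\models\ell\quad\Longrightarrow\quad\{P\cdot^{c,d}Q\}\cup\Pi\models\ell'.$$ -/

import Mathlib

universe u

namespace SecProt

/-- The basic sets of the model: identifiers, role names, (global) function symbols, labels, agents,
run identifiers, intruder-generated atoms, and names of further claims that may decorate protocols.
Functions only build long-term keys, so inversion of asymmetric keys is given by an involution on
function symbols (e.g. `pk ↔ sk`, `k ↔ k` for a symmetric key). -/
structure Signature where
  (Ident Role Func Label Agent RunId Intruder ExtraClaim : Type u)
  inv : Func → Func
  inv_inv : Function.Involutive inv
  trusted : Set Agent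

variable {S : Signature.{u}}

/-! ### Terms -/

inductive RoleTerm (S : Signature.{u}) : Type u
  | ident (x : S.Ident)
  | role (r : S.Role)
  | func (f : S.Func) (n : ℕ) (args : Fin n → RoleTerm S)
  | pair (x y : RoleTerm S)
  | enc (x y : RoleTerm S)

/-- Nonce run terms: `fresh c rid` is the constant `c` made unique by the run identifier `rid`. -/
inductive Nonce (S : Signature.{u}) : Type u
  | fresh (c : S.Ident) (rid : S.RunId)
  | intruder (t : S.Intruder)

inductive RunTerm (S : Signature.{u}) : Type u
  | agent (a : S.Agent)
  | nonce (n : Nonce S)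
  | func (f : S.Func) (n : ℕ) (args : Fin n → RunTerm S)
  | pair (u v : RunTerm S)
  | enc (u v : RunTerm S)

/-- The identifiers that appear in a role term. -/
def RoleTerm.idents : RoleTerm S → Set S.Ident
  | .ident x => {x}
  | .role _ => ∅
  | .func _ _ args => ⋃ k, (args k).idents
  | .pair x y => x.idents ∪ y.idents
  | .enc x y => x.idents ∪ y.idents

open Classical in
/-- `m[c/d]`: replace the identifier `d` by `c`. -/
noncomputable def RoleTerm.replace (c d : S.Ident) : RoleTerm S → RoleTerm S
  | .ident x => .ident (if x = d then c else x)
  | .role r => .role r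
  | .func f n args => .func f n fun k => (args k).replace c d
  | .pair x y => .pair (x.replace c d) (y.replace c d)
  | .enc x y => .enc (x.replace c d) (y.replace c d)

/-- The inverse key; every term that is not a long-term key is its own inverse. -/
def RunTerm.inverse : RunTerm S → RunTerm S
  | .func f n args => .func (S.inv f) n args
  | t => t

/-- No nonce of the form `fresh c rid` occurs in the run term. -/
def RunTerm.FreshFree : RunTerm S → Prop
  | .agent _ => True
  | .nonce (.fresh _ _) => False
  | .nonce (.intruder _) => True
  | .func _ _ args => ∀ k, (args k).FreshFree
  | .pair u v => u.FreshFree ∧ v.FreshFree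
  | .enc u v => u.FreshFree ∧ v.FreshFree

/-- Membership in the smallest closed superset of `K`. -/
inductive Derives (K : Set (RunTerm S)) : RunTerm S → Prop
  | mem {t} : t ∈ K → Derives K t
  | enc {u v} : Derives K u → Derives K v → Derives K (.enc u v)
  | dec {u v} : Derives K (.enc u v) → Derives K v.inverse → Derives K u
  | pair {u v} : Derives K u → Derives K v → Derives K (.pair u v)
  | fst {u v} : Derives K (.pair u v) → Derives K u
  | snd {u v} : Derives K (.pair u v) → Derives K v

def closureOf (K : Set (RunTerm S)) : Set (RunTerm S) := {t | Derives K t}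

/-- Admissible initial intruder knowledge: a closed set that contains all intruder-generated terms
and in which no nonce of a (future) run occurs. -/
structure IsInitialKnowledge (K : Set (RunTerm S)) : Prop where
  intruder_mem : ∀ t : S.Intruder, RunTerm.nonce (.intruder t) ∈ K
  closed : closureOf K ⊆ K
  fresh : ∀ t ∈ K, t.FreshFree

/-! ### Events, role specifications, protocols -/

inductive Claim (S : Signature.{u}) : Type u
  | secret
  | sessionUnique
  | dataAgree
  | session
  | weakSession
  | other (k : S.ExtraClaim)

/-- In `send` and `read` the first role is the (apparent) sender, the second one the recipient. -/
inductive Event (S : Signature.{u}) : Type u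
  | create (l : S.Label) (r : S.Role)
  | send (l : S.Label) (r r' : S.Role) (m : RoleTerm S)
  | read (l : S.Label) (r' r : S.Role) (m : RoleTerm S)
  | claim (l : S.Label) (r : S.Role) (cl : Claim S) (m : Option (RoleTerm S))
  | finish (l : S.Label) (r : S.Role)

def Event.label : Event S → S.Label
  | .create l _ => l
  | .send l _ _ _ => l
  | .read l _ _ _ => l
  | .claim l _ _ _ => l
  | .finish l _ => l

/-- The role that executes the event. -/
def Event.owner : Event S → S.Role
  | .create _ r => r
  | .send _ r _ _ => r
  | .read _ _ r _ => r
  | .claim _ r _ _ => r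
  | .finish _ r => r

def Event.idents : Event S → Set S.Ident
  | .create _ _ => ∅
  | .send _ _ _ m => m.idents
  | .read _ _ _ m => m.idents
  | .claim _ _ _ m => {x | ∃ t, m = some t ∧ x ∈ t.idents}
  | .finish _ _ => ∅

def Event.IsBoundary : Event S → Prop
  | .create _ _ => True
  | .finish _ _ => True
  | _ => False

/-- Apply a relabelling and a transformation of the role terms to an event. -/
def Event.map (g : S.Label → S.Label) (h : RoleTerm S → RoleTerm S) : Event S → Event S
  | .create l r => .create (g l) r
  | .send l r r' m => .send (g l) r r' (h m)
  | .read l r' r m => .read (g l) r' r (h m)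
  | .claim l r cl m => .claim (g l) r cl (m.map h)
  | .finish l r => .finish (g l) r

inductive IdType
  | const
  | param
  | var

/-- A role specification: event list and partial typing of the identifiers. -/
@[ext]
structure RoleSpec (S : Signature.{u}) : Type u where
  events : List (Event S)
  typer : S.Ident → Option IdType

/-- `rs` is a role specification with role name `r`. -/
structure RoleSpec.WellFormed (rs : RoleSpec S) (r : S.Role) : Prop where
  shape : ∃ l l' body, rs.events = Event.create l r :: (body ++ [Event.finish l' r]) ∧
    ∀ e ∈ body, ¬ e.IsBoundary ∧ e.owner = r
  typed : ∀ e ∈ rs.events, ∀ x ∈ e.idents, (rs.typer x).isSome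

/-- The variables of a role specification that appear in `m`. -/
def RoleSpec.vars (rs : RoleSpec S) (m : RoleTerm S) : Set S.Ident :=
  {x | x ∈ m.idents ∧ rs.typer x = some .var}

/-- A protocol is a partial map from role names to role specifications. -/
abbrev Protocol (S : Signature.{u}) : Type u := S.Role → Option (RoleSpec S)

namespace Protocol

/-- The set of labels of the events of a protocol. -/
def labels (P : Protocol S) : Set S.Label :=
  {l | ∃ r rs, P r = some rs ∧ ∃ e ∈ rs.events, e.label = l}

/-- The identifiers of a protocol. A role specification may also declare (type) identifiers that
occur in none of its events; these count as identifiers of the protocol. -/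
def idents (P : Protocol S) : Set S.Ident :=
  {x | ∃ r rs, P r = some rs ∧ (rs.typer x).isSome}

end Protocol

/-- `e` is a send event and `e'` the identically labelled read event. -/
def Corresponding (e e' : Event S) : Prop :=
  ∃ l r r' m m', e = .send l r r' m ∧ e' = .read l r r' m'

/-- Labels are unique within a protocol, except for those of corresponding send and read events. -/
structure Protocol.WellFormed (P : Protocol S) : Prop where
  spec : ∀ r rs, P r = some rs → rs.WellFormed r
  label_unique : ∀ (r₁ : S.Role) (rs₁ : RoleSpec S) (i₁ : ℕ) (e₁ : Event S)
    (r₂ : S.Role) (rs₂ : RoleSpec S) (i₂ : ℕ) (e₂ : Event S),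
    P r₁ = some rs₁ → rs₁.events[i₁]? = some e₁ →
    P r₂ = some rs₂ → rs₂.events[i₂]? = some e₂ → e₁.label = e₂.label →
    (r₁ = r₂ ∧ i₁ = i₂) ∨ Corresponding e₁ e₂ ∨ Corresponding e₂ e₁

/-- A set of protocols, in which every label is used in at most one protocol. -/
structure IsProtocolSet (Pi : Set (Protocol S)) : Prop where
  wellFormed : ∀ P ∈ Pi, P.WellFormed
  label_unique : ∀ P ∈ Pi, ∀ Q ∈ Pi, ∀ l, l ∈ P.labels → l ∈ Q.labels → P = Q

/-- The set of labels of a set of protocols. -/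
def labelsOf (Pi : Set (Protocol S)) : Set S.Label := {l | ∃ P ∈ Pi, l ∈ P.labels}

/-! ### Instantiations, runs, traces -/

/-- An instantiation `(rid, ρ, σ)`; variables and parameters take only nonce run terms as values. -/
@[ext]
structure Inst (S : Signature.{u}) : Type u where
  rid : S.RunId
  roles : S.Role → Option S.Agent
  subst : S.Ident → Option (Nonce S)

open Classical in
/-- Instantiation of a role term in the context of a typing; `none` if it is not defined. -/
noncomputable def Inst.eval (ty : S.Ident → Option IdType) (inst : Inst S) :
    RoleTerm S → Option (RunTerm S)
  | .ident x =>
      match ty x with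
      | some .const => some (.nonce (.fresh x inst.rid))
      | some .param => (inst.subst x).map .nonce
      | some .var => (inst.subst x).map .nonce
      | none => none
  | .role r => (inst.roles r).map .agent
  | .func f n args =>
      if h : ∀ k, (inst.eval ty (args k)).isSome then
        some (.func f n fun k => (inst.eval ty (args k)).get (h k))
      else none
  | .pair x y => (inst.eval ty x).bind fun u => (inst.eval ty y).map fun v => .pair u v
  | .enc x y => (inst.eval ty x).bind fun u => (inst.eval ty y).map fun v => .enc u v

/-- A run event `(inst, ev)`, kept together with the role specification in whose context `inst` is
applied (this specification is determined by the label and the role of `ev`). -/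
structure RunEvent (S : Signature.{u}) : Type u where
  spec : RoleSpec S
  inst : Inst S
  ev : Event S

/-- `inst(m)` in the context of the run event. -/
noncomputable def RunEvent.eval (e : RunEvent S) (m : RoleTerm S) : Option (RunTerm S) :=
  e.inst.eval e.spec.typer m

abbrev Trace (S : Signature.{u}) : Type u := List (RunEvent S)

/-- A run: its role specification, its instantiation, and the events that remain. -/
structure Run (S : Signature.{u}) : Type u where
  spec : RoleSpec S
  inst : Inst S
  rest : List (Event S)

/-- Intruder knowledge and the set of runs. Run identifiers are never reused, so the
set of runs is given as a partial function of the run identifier. -/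
structure State (S : Signature.{u}) : Type u where
  knowledge : Set (RunTerm S)
  runs : S.RunId → Option (Run S)

/-- `(inst, rs.events)` is an initial run for the role specification `rs` of `P`. -/
def IsInitialRun (P : Protocol S) (rs : RoleSpec S) (inst : Inst S) : Prop :=
  (∃ r, P r = some rs) ∧
  (∀ r, (inst.roles r).isSome ↔ (P r).isSome) ∧
  (∀ x, (inst.subst x).isSome ↔ rs.typer x = some .param)

/-- The match predicate in the context of `rs`. -/
def Match (rs : RoleSpec S) (inst : Inst S) (m : RoleTerm S) (t : RunTerm S) (inst' : Inst S) :
    Prop :=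
  inst'.rid = inst.rid ∧ inst'.roles = inst.roles ∧
  (∀ x n, inst.subst x = some n → inst'.subst x = some n) ∧
  (∀ x, (inst'.subst x).isSome ↔ (inst.subst x).isSome ∨ x ∈ rs.vars m) ∧
  inst'.eval rs.typer m = some t

open Classical in
/-- Replace (or add) the run with the run identifier of `run`. -/
noncomputable def State.setRun (st : State S) (run : Run S) : S.RunId → Option (Run S) :=
  Function.update st.runs run.inst.rid (some run)

/-- The derivation rules. -/
inductive Step (Pi : Set (Protocol S)) : State S → RunEvent S → State S → Prop
  | create {st P rs inst l r rest} :
      P ∈ Pi → IsInitialRun P rs inst → rs.events = .create l r :: rest →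
      st.runs inst.rid = none →
      Step Pi st ⟨rs, inst, .create l r⟩ ⟨st.knowledge, st.setRun ⟨rs, inst, rest⟩⟩
  | finish {st rs inst l r} :
      st.runs inst.rid = some ⟨rs, inst, [.finish l r]⟩ →
      Step Pi st ⟨rs, inst, .finish l r⟩ ⟨st.knowledge, st.setRun ⟨rs, inst, []⟩⟩
  | send {st rs inst l r r' m rest t} :
      st.runs inst.rid = some ⟨rs, inst, .send l r r' m :: rest⟩ →
      inst.eval rs.typer m = some t →
      Step Pi st ⟨rs, inst, .send l r r' m⟩
        ⟨closureOf (st.knowledge ∪ {t}), st.setRun ⟨rs, inst, rest⟩⟩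
  | read {st rs inst inst' l r' r m rest t} :
      st.runs inst.rid = some ⟨rs, inst, .read l r' r m :: rest⟩ →
      t ∈ st.knowledge → Match rs inst m t inst' →
      Step Pi st ⟨rs, inst', .read l r' r m⟩ ⟨st.knowledge, st.setRun ⟨rs, inst', rest⟩⟩
  | claim {st rs inst l r cl m rest} :
      st.runs inst.rid = some ⟨rs, inst, .claim l r cl m :: rest⟩ →
      Step Pi st ⟨rs, inst, .claim l r cl m⟩ ⟨st.knowledge, st.setRun ⟨rs, inst, rest⟩⟩

/-- The trace `α` leads from the initial state to the given state. -/
inductive Reaches (K₀ : Set (RunTerm S)) (Pi : Set (Protocol S)) : Trace S → State S → Prop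
  | nil : Reaches K₀ Pi [] ⟨K₀, fun _ => none⟩
  | snoc {α st e st'} : Reaches K₀ Pi α st → Step Pi st e st' → Reaches K₀ Pi (α ++ [e]) st'

/-- The set of valid traces of a protocol set. -/
def traces (K₀ : Set (RunTerm S)) (Pi : Set (Protocol S)) : Set (Trace S) :=
  {α | ∃ st, Reaches K₀ Pi α st}

/-- `κ` (restricted to the roles of `P`) is a cast for `P` in `α`. -/
def IsCast (P : Protocol S) (α : Trace S) (κ : S.Role → S.RunId) : Prop :=
  ∃ ρ : S.Role → Option S.Agent, ∀ r, (P r).isSome →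
    ∃ e ∈ α, ∃ l ∈ P.labels, e.ev = .create l r ∧ e.inst.rid = κ r ∧ e.inst.roles = ρ

/-! ### Passing output of one protocol set to another -/

/-- `P` establishes `c`: in every trace of every protocol set that contains `P`, the instantiation
is defined at `c` whenever a role of `P` ends. -/
def Establishes (K₀ : Set (RunTerm S)) (P : Protocol S) (c : S.Ident) : Prop :=
  ∀ Pi : Set (Protocol S), IsProtocolSet Pi → P ∈ Pi → ∀ α ∈ traces K₀ Pi,
    ∀ e ∈ α, ∀ l r, e.ev = .finish l r → l ∈ P.labels → (e.eval (.ident c)).isSome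

/-- The positions of the create events of role `r` in `α` that belong to `Pi''`, receive in `d` the
same value as the run event `e`, and agree with it on all agents. -/
def inputPositions (Pi'' : Set (Protocol S)) (d : S.Ident) (α : Trace S) (e : RunEvent S)
    (r : S.Role) : Set ℕ :=
  {j | ∃ e' l, α[j]? = some e' ∧ e'.ev = .create l r ∧ l ∈ labelsOf Pi'' ∧
    e'.eval (.ident d) = e.eval (.ident d) ∧ e'.inst.roles = e.inst.roles}

/-- The positions of the end events of role `r` in `α` that belong to `Pi'`, have recorded in `c`
the value that the run event `e` has in `d`, and agree with it on all agents. -/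
def outputPositions (Pi' : Set (Protocol S)) (c d : S.Ident) (α : Trace S) (e : RunEvent S)
    (r : S.Role) : Set ℕ :=
  {j | ∃ e' l, α[j]? = some e' ∧ e'.ev = .finish l r ∧ l ∈ labelsOf Pi' ∧
    e'.eval (.ident c) = e.eval (.ident d) ∧ e'.inst.roles = e.inst.roles}

/-- The trace restriction by which `Pi''` takes its input `d` from the output `c` of `Pi'`, each run
of a role of `Pi'` providing input for at most one run of the same role of `Pi''`. -/
def UniqueInput (Pi' Pi'' : Set (Protocol S)) (c d : S.Ident) (α : Trace S) : Prop :=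
  ∀ (i : ℕ) e l r, α[i]? = some e → e.ev = .create l r → l ∈ labelsOf Pi'' →
    ∃ f : ℕ → ℕ,
      Set.MapsTo f (inputPositions Pi'' d α e r) (outputPositions Pi' c d α e r) ∧
      Set.InjOn f (inputPositions Pi'' d α e r) ∧
      ∀ j ∈ inputPositions Pi'' d α e r, f j < j

/-! ### Security properties -/

/-- A security property: evaluated for a protocol set, a claim event with label `l`, role `r` and
argument `m`, an instantiation (given, with its context, by the run event `e`), and a trace. -/
abbrev SecurityProperty (S : Signature.{u}) : Type u :=
  Set (Protocol S) → S.Label → S.Role → RoleTerm S → RunEvent S → Trace S → Prop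

/-- All agents of the run are trusted. -/
def RunEvent.Trusted (e : RunEvent S) : Prop :=
  ∀ r a, e.inst.roles r = some a → a ∈ S.trusted

/-- The protocol set `Pi`, under the trace restriction `χ`, satisfies the claim labelled `l`, where
`f` is the security property of that claim. -/
def Satisfies (K₀ : Set (RunTerm S)) (Pi : Set (Protocol S)) (χ : Trace S → Prop)
    (f : SecurityProperty S) (l : S.Label) : Prop :=
  ∀ α ∈ traces K₀ Pi, χ α → ∀ e ∈ α, ∀ r cl m, e.ev = .claim l r cl (some m) →
    f Pi l r m e α ∨ ¬ e.Trusted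

/-- Secrecy: after the whole trace, the intruder does not know `inst(m)`. -/
def secretProp (K₀ : Set (RunTerm S)) : SecurityProperty S := fun Pi _ _ m e α =>
  ∀ st, Reaches K₀ Pi α st → ∀ t, e.eval m = some t → t ∉ st.knowledge

def sessionUniqueProp : SecurityProperty S := fun _ l r m e α =>
  ∀ (i j : ℕ) e₁ e₂ cl₁ cl₂ m₁ m₂ t, α[i]? = some e₁ → α[j]? = some e₂ →
    e₁.ev = .claim l r cl₁ m₁ → e₂.ev = .claim l r cl₂ m₂ →
    e₁.eval m = some t → e₂.eval m = some t → e.eval m = some t → i = j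

def dataAgreeProp : SecurityProperty S := fun Pi l _ m e α =>
  ∃ P ∈ Pi, l ∈ P.labels ∧ ∃ κ, IsCast P α κ ∧
    ∀ r', (P r').isSome → ∃ e' ∈ α, e'.inst.rid = κ r' ∧
      ∃ t, e'.eval m = some t ∧ e.eval m = some t

def sessionProp (K₀ : Set (RunTerm S)) : SecurityProperty S := fun Pi l r m e α =>
  secretProp K₀ Pi l r m e α ∧ sessionUniqueProp Pi l r m e α ∧ dataAgreeProp Pi l r m e α

def weakSessionProp (K₀ : Set (RunTerm S)) : SecurityProperty S := fun Pi l r m e α =>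
  secretProp K₀ Pi l r m e α ∧ sessionUniqueProp Pi l r m e α

/-- `l` is the label of a claim event of `P` with claim `cl` (and some argument). -/
def IsClaimLabel (P : Protocol S) (cl : Claim S) (l : S.Label) : Prop :=
  ∃ r rs m, P r = some rs ∧ Event.claim l r cl (some m) ∈ rs.events

/-! ### Chaining composition -/

open Classical in
/-- `rs[c/d]`: replace `d` by `c` in a role specification. -/
noncomputable def RoleSpec.replace (c d : S.Ident) (rs : RoleSpec S) : RoleSpec S where
  events := rs.events.map (Event.map id (RoleTerm.replace c d))
  typer x := if x = c then rs.typer d else if x = d then none else rs.typer x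

/-- Sequential composition: the final end event of `rs₁` and the initial create event of `rs₂` are
dropped. -/
def RoleSpec.seq (rs₁ rs₂ : RoleSpec S) : RoleSpec S where
  events := rs₁.events.dropLast ++ rs₂.events.tail
  typer x := (rs₁.typer x).or (rs₂.typer x)

def RoleSpec.relabel (g : S.Label → S.Label) (rs : RoleSpec S) : RoleSpec S where
  events := rs.events.map (Event.map g id)
  typer := rs.typer

/-- The chaining composition of `P` and `Q`, passing `c` to `d`, with events relabelled by `g`. -/
noncomputable def chain (g : S.Label → S.Label) (P Q : Protocol S) (c d : S.Ident) :
    Protocol S := fun r =>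
  match P r, Q r with
  | some rs₁, some rs₂ => some ((rs₁.seq (rs₂.replace c d)).relabel g)
  | _, _ => none

/-- The conditions under which the chaining composition is defined. -/
structure ChainDefined (K₀ : Set (RunTerm S)) (P Q : Protocol S) (c d : S.Ident) : Prop where
  sameRoles : ∀ r, (P r).isSome ↔ (Q r).isSome
  disjoint : Disjoint P.idents Q.idents
  establishes : Establishes K₀ P c
  isParam : ∀ r rs, Q r = some rs → rs.typer d = some .param

end SecProt

/-! A trace `α` of the composition becomes a trace `β` of `{P, Q} ∪ Pi` by cutting every composed
run in two. The run `rid` plays its first half as a run of `P` under its own identifier, and its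
second half as a run of `Q` under a new identifier `τ rid`. A constant of `Q` carries `rid` in `α`
but must carry `τ rid` in `β`, so messages agree only up to the nonce permutation `Nonce.shift
Q.idents τ`. That permutation does no harm elsewhere: `P` shares no identifier with `Q`, and `τ`
fixes the identifiers of the remaining runs. Derivability is equivariant and `K₀` contains no run
constant, so the intruder knowledge along `β` is always the renamed knowledge along `α`
(`Step.view`, `Splitting.simulate`).

Where a composed run enters its second half, `β` receives two extra adjacent events, the end of the
`P` run and the creation of the `Q` run (`Splitting.cross`). Neither requires anything from the
intruder, and since `P` establishes `c`, its value is defined there and can be handed to `d`.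
Adjacency makes `j ↦ j - 1` the injection demanded by the trace restriction
(`TraceSim.uniqueInput`), so the hypothesis applies to `β`.

A claim of `α` has a counterpart in `β` with the same agents. Secrecy returns because the knowledge
is a renamed copy, uniqueness because the positions of `α` embed injectively into those of `β`, and
data agreement because every `P` or `Q` run of `β` is half of a composed run, so that a cast can be
pulled back along the map of run identifiers (`StateSim.secret_of_part`,
`Splitting.sessionUnique_of_part`, `Splitting.dataAgree_of_part`). -/

namespace SecProt

variable {S : Signature.{u}}

/-! ### Renaming nonces -/

/-- Apply a map of nonces inside a run term. -/
def RunTerm.rename (f : Nonce S → Nonce S) : RunTerm S → RunTerm S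
  | .agent a => .agent a
  | .nonce n => .nonce (f n)
  | .func h n args => .func h n fun k => (args k).rename f
  | .pair u v => .pair (u.rename f) (v.rename f)
  | .enc u v => .enc (u.rename f) (v.rename f)

theorem RunTerm.rename_symm_rename (θ : Equiv.Perm (Nonce S)) (t : RunTerm S) :
    (t.rename θ).rename θ.symm = t := by
  induction t <;> simp_all [RunTerm.rename]

theorem RunTerm.rename_rename_symm (θ : Equiv.Perm (Nonce S)) (t : RunTerm S) :
    (t.rename θ.symm).rename θ = t := by
  induction t <;> simp_all [RunTerm.rename]

theorem RunTerm.rename_inverse (f : Nonce S → Nonce S) (t : RunTerm S) :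
    t.inverse.rename f = (t.rename f).inverse := by
  cases t <;> rfl

theorem RunTerm.FreshFree.rename_eq {f : Nonce S → Nonce S}
    (hf : ∀ t, f (.intruder t) = .intruder t) {t : RunTerm S} (ht : t.FreshFree) :
    t.rename f = t := by
  induction t with
  | agent a => rfl
  | nonce n => cases n with
    | fresh c rid => exact ht.elim
    | intruder t => simp [RunTerm.rename, hf]
  | func h n args ih => simp only [RunTerm.rename]; congr 1; funext k; exact ih k (ht k)
  | pair u v hu hv => simp [RunTerm.rename, hu ht.1, hv ht.2]
  | enc u v hu hv => simp [RunTerm.rename, hu ht.1, hv ht.2]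

theorem Derives.rename (f : Nonce S → Nonce S) {K : Set (RunTerm S)} {t : RunTerm S}
    (h : Derives K t) : Derives (RunTerm.rename f '' K) (t.rename f) := by
  induction h with
  | mem h => exact .mem ⟨_, h, rfl⟩
  | enc _ _ hu hv => exact .enc hu hv
  | dec _ _ hu hv => exact .dec hu (by rwa [← RunTerm.rename_inverse])
  | pair _ _ hu hv => exact .pair hu hv
  | fst _ h => exact .fst h
  | snd _ h => exact .snd h

/-- Derivations are equivariant. The inclusion from left to right needs the inverse permutation: a
renaming that identified nonces could enable new decryptions. -/
theorem closureOf_image_rename (θ : Equiv.Perm (Nonce S)) (K : Set (RunTerm S)) :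
    closureOf (RunTerm.rename θ '' K) = RunTerm.rename θ '' closureOf K := by
  ext t
  constructor
  · intro h
    refine ⟨t.rename θ.symm, ?_, RunTerm.rename_rename_symm θ t⟩
    have := Derives.rename θ.symm h
    rwa [Set.image_image, funext (RunTerm.rename_symm_rename θ), Set.image_id'] at this
  · rintro ⟨t, h, rfl⟩
    exact Derives.rename θ h

theorem IsInitialKnowledge.image_rename {K : Set (RunTerm S)} (hK : IsInitialKnowledge K)
    {f : Nonce S → Nonce S} (hf : ∀ t, f (.intruder t) = .intruder t) :
    RunTerm.rename f '' K = K := by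
  have h : Set.EqOn (RunTerm.rename f) id K := fun t ht => (hK.fresh t ht).rename_eq hf
  rw [h.image_eq, Set.image_id]

/-! ### Replacement in terms and events -/

theorem RoleTerm.replace_self (c : S.Ident) (m : RoleTerm S) : m.replace c c = m := by
  induction m with
  | ident x => simp only [RoleTerm.replace]; split_ifs <;> simp_all
  | _ => simp_all [RoleTerm.replace]

open Classical in
theorem RoleTerm.mem_idents_replace {c d x : S.Ident} {m : RoleTerm S} :
    x ∈ (m.replace c d).idents ↔ ∃ y ∈ m.idents, (if y = d then c else y) = x := by
  induction m with
  | ident y => simp [RoleTerm.replace, RoleTerm.idents, eq_comm]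
  | role r => simp [RoleTerm.replace, RoleTerm.idents]
  | func f n args ih =>
    simp only [RoleTerm.replace, RoleTerm.idents, Set.mem_iUnion, ih]
    constructor
    · rintro ⟨k, y, hy, h⟩; exact ⟨y, ⟨k, hy⟩, h⟩
    · rintro ⟨y, ⟨k, hy⟩, h⟩; exact ⟨k, y, hy, h⟩
  | pair u v hu hv => simp only [RoleTerm.replace, RoleTerm.idents, Set.mem_union, hu, hv, or_and_right,
      exists_or]
  | enc u v hu hv => simp only [RoleTerm.replace, RoleTerm.idents, Set.mem_union, hu, hv, or_and_right,
      exists_or]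

theorem Event.map_map (g g' : S.Label → S.Label) (h h' : RoleTerm S → RoleTerm S) (e : Event S) :
    (e.map g h).map g' h' = e.map (g' ∘ g) (h' ∘ h) := by
  cases e <;> simp [Event.map]

theorem Event.map_id (e : Event S) : e.map id id = e := by
  cases e <;> simp [Event.map]

theorem RoleTerm.replace_self_eq_id (c : S.Ident) :
    (RoleTerm.replace c c : RoleTerm S → RoleTerm S) = id :=
  funext (RoleTerm.replace_self c)

/-! ### Evaluation and views of instantiations -/

/-- The nonce that an instantiation assigns to an identifier in the context of a typing. -/
def Inst.value (ty : S.Ident → Option IdType) (inst : Inst S) (x : S.Ident) : Option (Nonce S) :=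
  match ty x with
  | some .const => some (.fresh x inst.rid)
  | some .param => inst.subst x
  | some .var => inst.subst x
  | none => none

theorem Inst.eval_ident (ty : S.Ident → Option IdType) (inst : Inst S) (x : S.Ident) :
    inst.eval ty (.ident x) = (inst.value ty x).map .nonce := by
  unfold Inst.eval Inst.value
  cases ty x with
  | none => rfl
  | some k => cases k <;> rfl

theorem Inst.typed_of_eval {ty : S.Ident → Option IdType} {inst : Inst S} {m : RoleTerm S} :
    (inst.eval ty m).isSome → ∀ x ∈ m.idents, (ty x).isSome := by
  induction m with
  | ident y =>
    rintro h x rfl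
    rw [Inst.eval_ident, Option.isSome_map] at h
    unfold Inst.value at h
    split at h <;> simp_all
  | role r => simp [RoleTerm.idents]
  | func f n args ih =>
    intro h x hx
    simp only [Inst.eval] at h
    obtain ⟨k, hk⟩ := Set.mem_iUnion.1 hx
    split_ifs at h with hs
    · exact ih k (hs k) x hk
    · simp at h
  | pair u v hu hv =>
    intro h x hx
    simp only [Inst.eval, Option.isSome_bind, Option.isSome_map] at h
    rcases hx with hx | hx <;> cases h1 : inst.eval ty u <;> cases h2 : inst.eval ty v <;> simp_all
  | enc u v hu hv =>
    intro h x hx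
    simp only [Inst.eval, Option.isSome_bind, Option.isSome_map] at h
    rcases hx with hx | hx <;> cases h1 : inst.eval ty u <;> cases h2 : inst.eval ty v <;> simp_all

open Classical in
/-- The instantiation seen from a component with typing `ty'`: nonces are renamed by `θ`, and `d`
receives the value of `c`. -/
noncomputable def Inst.view (θ : Equiv.Perm (Nonce S)) (c d : S.Ident)
    (ty ty' : S.Ident → Option IdType) (rid' : S.RunId) (inst : Inst S) : Inst S where
  rid := rid'
  roles := inst.roles
  subst x := if ty' x = some .param ∨ ty' x = some .var then
    (inst.value ty (if x = d then c else x)).map θ else none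

/-- The conditions under which a component with typing `ty'` may be viewed through `Inst.view`. -/
structure Compat (θ : Equiv.Perm (Nonce S)) (c d : S.Ident) (ty ty' : S.Ident → Option IdType)
    (rid rid' : S.RunId) : Prop where
  agree : ∀ x, (ty' x).isSome → (x = d → d = c) → ty x = ty' x
  const : ∀ x, ty' x = some .const → θ (.fresh x rid) = .fresh x rid'
  input : d = c ∨ (ty' c = none ∧ ty' d = some .param)

section View

variable {θ : Equiv.Perm (Nonce S)} {c d : S.Ident} {ty ty' : S.Ident → Option IdType}
  {rid' : S.RunId} {inst : Inst S}

open Classical in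
theorem Compat.value_view (H : Compat θ c d ty ty' inst.rid rid') {x : S.Ident}
    (hx : (ty' x).isSome) :
    (inst.view θ c d ty ty' rid').value ty' x =
      (inst.value ty (if x = d then c else x)).map θ := by
  obtain ⟨k, hk⟩ := Option.isSome_iff_exists.1 hx
  cases k with
  | const =>
    have hd : x = d → d = c := by
      rintro rfl
      rcases H.input with h | h
      · exact h
      · simp [hk] at h
    have h1 : (if x = d then c else x) = x := by
      split_ifs with h
      · rw [h]; exact (hd h).symm
      · rfl
    rw [h1]
    simp [Inst.value, hk, H.agree x hx hd, H.const x hk, Inst.view]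
  | param => simp [Inst.value, hk, Inst.view]
  | var => simp [Inst.value, hk, Inst.view]

/-- Renaming and replacement both commute with the term constructors, so everything reduces to
identifiers, where the view was defined to make it true. All transfers of messages between the
composition and its components rest on this identity. -/
theorem Compat.eval_view (H : Compat θ c d ty ty' inst.rid rid') {m : RoleTerm S}
    (hm : ∀ x ∈ m.idents, (ty' x).isSome) :
    (inst.view θ c d ty ty' rid').eval ty' m =
      (inst.eval ty (m.replace c d)).map (RunTerm.rename θ) := by
  induction m with
  | ident x =>
    rw [Inst.eval_ident, H.value_view (hm x rfl), RoleTerm.replace, Inst.eval_ident,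
      Option.map_map, Option.map_map]
    rfl
  | role r => simp only [RoleTerm.replace, Inst.eval, Option.map_map]; rfl
  | func f n args ih =>
    have ih' := fun k => ih k fun x hx => hm x (Set.mem_iUnion.2 ⟨k, hx⟩)
    simp only [RoleTerm.replace, Inst.eval, ih', Option.isSome_map]
    split_ifs with h
    · simp [RunTerm.rename, Option.get_map]
    · rfl
  | pair u v hu hv =>
    rw [Inst.eval, hu fun x hx => hm x (.inl hx), hv fun x hx => hm x (.inr hx), RoleTerm.replace,
      Inst.eval]
    cases inst.eval ty (u.replace c d) <;> cases inst.eval ty (v.replace c d) <;> rfl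
  | enc u v hu hv =>
    rw [Inst.eval, hu fun x hx => hm x (.inl hx), hv fun x hx => hm x (.inr hx), RoleTerm.replace,
      Inst.eval]
    cases inst.eval ty (u.replace c d) <;> cases inst.eval ty (v.replace c d) <;> rfl

/-- Definedness already forces the identifiers of `m` to be typed. Data agreement needs this form,
because there `m` is read in the specifications of other roles, where its typing is not known
beforehand. -/
theorem Compat.eval_of_eval_view (H : Compat θ c d ty ty' inst.rid rid') {m : RoleTerm S}
    {t : RunTerm S} (h : (inst.view θ c d ty ty' rid').eval ty' m = some t) :
    inst.eval ty (m.replace c d) = some (t.rename θ.symm) := by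
  have hm := Inst.typed_of_eval (by rw [h]; rfl : (Inst.eval ty' _ m).isSome)
  rw [H.eval_view hm, Option.map_eq_some_iff] at h
  obtain ⟨t, h, rfl⟩ := h
  rw [h, RunTerm.rename_symm_rename]

theorem Inst.value_mono {inst' : Inst S} (hr : inst'.rid = inst.rid)
    (h : ∀ x n, inst.subst x = some n → inst'.subst x = some n) {x : S.Ident} {n : Nonce S}
    (hx : inst.value ty x = some n) : inst'.value ty x = some n := by
  unfold Inst.value at hx ⊢
  split <;> simp_all

/-- The delicate point is that a read must bind exactly the variables of the message on both sides.
For the input `d` this holds because `d` is a parameter, bound from the start to the value of `c`;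
hence the hypothesis that `c` already has a value. -/
theorem Match.view {rs rs' : RoleSpec S} {inst' : Inst S} {m : RoleTerm S} {t : RunTerm S}
    (H : Compat θ c d rs.typer rs'.typer inst.rid rid')
    (hm : ∀ x ∈ m.idents, (rs'.typer x).isSome)
    (hc : d = c ∨ (inst.value rs.typer c).isSome)
    (h : Match rs inst (m.replace c d) t inst') :
    Match rs' (inst.view θ c d rs.typer rs'.typer rid') m (t.rename θ)
      (inst'.view θ c d rs.typer rs'.typer rid') := by
  classical
  obtain ⟨hr, hρ, hmono, hdom, hev⟩ := h
  have vm := fun x n => Inst.value_mono (ty := rs.typer) (x := x) (n := n) hr hmono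
  refine ⟨rfl, hρ, ?_, ?_, ?_⟩
  · intro x n hx
    simp only [Inst.view] at hx ⊢
    split_ifs at hx ⊢ with h1
    all_goals
      obtain ⟨n', hn, rfl⟩ := Option.map_eq_some_iff.1 hx
      rw [vm _ _ hn]; rfl
  · intro x
    simp only [Inst.view, RoleSpec.vars, Set.mem_ofPred_eq]
    by_cases h1 : rs'.typer x = some .param ∨ rs'.typer x = some .var
    · rw [if_pos h1, if_pos h1, Option.isSome_map, Option.isSome_map]
      have hs : (rs'.typer x).isSome := by rcases h1 with h | h <;> simp [h]
      by_cases hd : x = d → d = c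
      · have h2 : (if x = d then c else x) = x := by
          split_ifs with h
          · rw [h]; exact (hd h).symm
          · rfl
        have h3 := H.agree x hs hd
        have h4 : ∀ i : Inst S, i.value rs.typer x = i.subst x := by
          intro i; unfold Inst.value; rcases h1 with h | h <;> simp [h3, h]
        rw [h2, h4, h4, hdom, RoleSpec.vars, Set.mem_ofPred_eq, RoleTerm.mem_idents_replace, h3]
        refine or_congr_right (and_congr_left fun hv => ⟨?_, fun hx => ⟨x, hx, h2⟩⟩)
        rintro ⟨y, hy, rfl⟩
        split_ifs with h5
        -- An occurrence of `x` created by replacing `d` means `x = c`, and the component does not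
        -- type `c` unless `c = d`.
        · rcases H.input with h6 | h6
          · rw [← h6, ← h5]; exact hy
          · rw [if_pos h5] at hs; simp [h6.1] at hs
        · exact hy
      -- Remaining case `x = d ≠ c`: both sides are defined before the read, and `d` is not a
      -- variable.
      · push Not at hd
        obtain ⟨rfl, hne⟩ := hd
        have h2 := (H.input.resolve_left hne).2
        have h3 := hc.resolve_left hne
        obtain ⟨n, hn⟩ := Option.isSome_iff_exists.1 h3
        simp [hn, vm _ _ hn, h2]
    · rw [if_neg h1, if_neg h1]
      have : rs'.typer x ≠ some .var := fun h => h1 (.inr h)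
      simp [this]
  · have H' : Compat θ c d rs.typer rs'.typer inst'.rid rid' := by rw [hr]; exact H
    rw [H'.eval_view hm, hev]; rfl

end View

/-! ### Steps and reachable states -/

/-- Only creation needs an unused run identifier; the other four rules share one shape, consuming
the next event of a run whose substitution grows at most by variables of that event. -/
theorem Step.cases {Pi : Set (Protocol S)} {st st' : State S} {e : RunEvent S}
    (h : Step Pi st e st') :
    ∃ rest, st'.runs = st.setRun ⟨e.spec, e.inst, rest⟩ ∧
      ((∃ R ∈ Pi, IsInitialRun R e.spec e.inst ∧ (∃ l r, e.ev = .create l r) ∧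
          e.spec.events = e.ev :: rest ∧ st.runs e.inst.rid = none ∧
          st'.knowledge = st.knowledge) ∨
        (∀ l r, e.ev ≠ .create l r) ∧ ∃ inst : Inst S, inst.rid = e.inst.rid ∧ inst.roles = e.inst.roles ∧
          st.runs e.inst.rid = some ⟨e.spec, inst, e.ev :: rest⟩ ∧
          (∀ x, (e.inst.subst x).isSome →
            (inst.subst x).isSome ∨ x ∈ e.ev.idents ∧ e.spec.typer x = some .var) ∧
          ∀ x n, inst.subst x = some n → e.inst.subst x = some n) := by
  cases h with
  | create hR hi he hf =>
    exact ⟨_, rfl, .inl ⟨_, hR, hi, ⟨_, _, rfl⟩, he, hf, rfl⟩⟩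
  | finish h => exact ⟨_, rfl, .inr ⟨by simp, _, rfl, rfl, h, fun x hx => .inl hx, fun x n hx => hx⟩⟩
  | send h _ => exact ⟨_, rfl, .inr ⟨by simp, _, rfl, rfl, h, fun x hx => .inl hx, fun x n hx => hx⟩⟩
  | read h _ hm =>
    exact ⟨_, rfl, .inr ⟨by simp, _, hm.1.symm, hm.2.1.symm, by simpa only [hm.1] using h,
      fun x hx => (hm.2.2.2.1 x).1 hx, hm.2.2.1⟩⟩
  | claim h => exact ⟨_, rfl, .inr ⟨by simp, _, rfl, rfl, h, fun x hx => .inl hx, fun x n hx => hx⟩⟩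

/-- Rule by rule, the component can imitate the composition because a sent term is renamed together
with the knowledge, and a readable term stays readable after renaming. The condition on `rest`
serves the end rule, which requires the end event to be the last one. -/
theorem Step.view {Pi Pi' : Set (Protocol S)} {st st' sb : State S} {e : RunEvent S}
    {θ : Equiv.Perm (Nonce S)} {c d : S.Ident} {g : S.Label → S.Label} {rs rs' : RoleSpec S}
    {inst : Inst S} {ev : Event S} {rest rest' : List (Event S)} {rid' : S.RunId}
    (h : Step Pi st e st')
    (hrun : st.runs e.inst.rid = some ⟨rs, inst, ev.map g (RoleTerm.replace c d) :: rest⟩)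
    (hrun' : sb.runs rid' = some ⟨rs', inst.view θ c d rs.typer rs'.typer rid', ev :: rest'⟩)
    (hK : sb.knowledge = RunTerm.rename θ '' st.knowledge)
    (H : Compat θ c d rs.typer rs'.typer e.inst.rid rid')
    (hev : ∀ x ∈ ev.idents, (rs'.typer x).isSome)
    (hrest : rest = [] → rest' = [])
    (hc : d = c ∨ (inst.value rs.typer c).isSome) :
    ∃ sb', Step Pi' sb ⟨rs', e.inst.view θ c d rs.typer rs'.typer rid', ev⟩ sb' ∧
      sb'.knowledge = RunTerm.rename θ '' st'.knowledge ∧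
      sb'.runs = sb.setRun ⟨rs', e.inst.view θ c d rs.typer rs'.typer rid', rest'⟩ := by
  cases h with
  | create _ _ _ hf => simp [hf] at hrun
  | finish h =>
    rw [h] at hrun
    cases ev <;> simp only [Event.map, Option.some.injEq, Run.mk.injEq, List.cons.injEq,
      reduceCtorEq, false_and, and_false] at hrun
    obtain ⟨rfl, rfl, _, h5⟩ := hrun
    obtain rfl := hrest h5.symm
    exact ⟨_, .finish hrun', hK, rfl⟩
  | send h ht =>
    rw [h] at hrun
    cases ev <;> simp only [Event.map, Option.some.injEq, Run.mk.injEq, List.cons.injEq,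
      reduceCtorEq, false_and, and_false] at hrun
    obtain ⟨rfl, rfl, he, rfl⟩ := hrun
    injection he with _ _ _ he
    subst he
    refine ⟨_, .send hrun' ((H.eval_view hev).trans (congrArg _ ht)), ?_, rfl⟩
    rw [hK, ← closureOf_image_rename, Set.image_union, Set.image_singleton]
  | read h ht hm =>
    rw [hm.1, h] at hrun
    cases ev <;> simp only [Event.map, Option.some.injEq, Run.mk.injEq, List.cons.injEq,
      reduceCtorEq, false_and, and_false] at hrun
    obtain ⟨rfl, rfl, he, rfl⟩ := hrun
    injection he with _ _ _ he
    subst he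
    rw [hm.1] at H
    exact ⟨_, .read hrun' (by rw [hK]; exact ⟨_, ht, rfl⟩) (Match.view H hev hc hm), hK, rfl⟩
  | claim h =>
    rw [h] at hrun
    cases ev <;> simp only [Event.map, Option.some.injEq, Run.mk.injEq, List.cons.injEq,
      reduceCtorEq, false_and, and_false] at hrun
    obtain ⟨rfl, rfl, _, rfl⟩ := hrun
    exact ⟨_, .claim hrun', hK, rfl⟩

/-- What the runs of a reachable state have in common with the trace that leads to it. -/
structure RunHistory (Pi : Set (Protocol S)) (α : Trace S) (rid : S.RunId) (run : Run S) :
    Prop where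
  rid_eq : run.inst.rid = rid
  spec : ∃ R ∈ Pi, (∃ r, R r = some run.spec) ∧ ∀ r, (run.inst.roles r).isSome ↔ (R r).isSome
  rest : ∀ ev ∈ run.rest, ev ∈ run.spec.events
  last : ∃ e ∈ α, e.spec = run.spec ∧ e.inst = run.inst
  first : ∃ e ∈ α, e.spec = run.spec ∧ e.inst.rid = rid ∧ e.inst.roles = run.inst.roles ∧
    (∃ l r, e.ev = .create l r) ∧ e.ev ∈ run.spec.events

theorem State.setRun_self (st : State S) (run : Run S) :
    st.setRun run run.inst.rid = some run := by
  simp [State.setRun]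

theorem State.setRun_of_ne (st : State S) {run : Run S} {rid : S.RunId} (h : rid ≠ run.inst.rid) :
    st.setRun run rid = st.runs rid := by
  classical exact Function.update_of_ne h _ _

theorem State.setRun_cases {st : State S} {run : Run S} {rid : S.RunId} {run' : Run S}
    (h : st.setRun run rid = some run') :
    (rid = run.inst.rid ∧ run' = run) ∨ (rid ≠ run.inst.rid ∧ st.runs rid = some run') := by
  by_cases hr : rid = run.inst.rid
  · subst hr; rw [State.setRun_self] at h; injection h with h; exact .inl ⟨rfl, h.symm⟩
  · rw [State.setRun_of_ne _ hr] at h; exact .inr ⟨hr, h⟩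

theorem Reaches.history {K : Set (RunTerm S)} {Pi : Set (Protocol S)} {α : Trace S} {st : State S}
    (h : Reaches K Pi α st) :
    ∀ rid run, st.runs rid = some run → RunHistory Pi α rid run := by
  induction h with
  | nil => intro rid run h; simp at h
  | @snoc α st e st' _ hs ih =>
    intro rid run hrun
    obtain ⟨rest, hst, hcase⟩ := hs.cases
    rw [hst] at hrun
    rcases State.setRun_cases hrun with ⟨rfl, rfl⟩ | ⟨_, hrun⟩
    · rcases hcase with ⟨R, hR, hi, hcr, hev, _⟩ | ⟨_, inst, hr, hρ, hrun, _⟩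
      · exact ⟨rfl, ⟨R, hR, hi.1, hi.2.1⟩, fun ev h => by simp only at h ⊢; rw [hev]; exact .tail _ h,
          ⟨e, by simp, rfl, rfl⟩, ⟨e, by simp, rfl, rfl, rfl, hcr, by simp [hev]⟩⟩
      · have h0 := ih _ _ hrun
        obtain ⟨e₀, h1, h2, h3, h4, h5⟩ := h0.first
        exact ⟨rfl, hρ ▸ h0.spec, fun ev h => h0.rest ev (.tail _ h), ⟨e, by simp, rfl, rfl⟩,
          ⟨e₀, by simp [h1], h2, h3, h4.trans hρ, h5⟩⟩
    · have h0 := ih _ _ hrun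
      obtain ⟨e₀, h1, h2⟩ := h0.first
      obtain ⟨e₁, h3, h4⟩ := h0.last
      exact ⟨h0.rid_eq, h0.spec, h0.rest, ⟨e₁, by simp [h3], h4⟩, ⟨e₀, by simp [h1], h2⟩⟩

theorem Reaches.event {K : Set (RunTerm S)} {Pi : Set (Protocol S)} {α : Trace S} {st : State S}
    (h : Reaches K Pi α st) :
    ∀ e ∈ α, e.ev ∈ e.spec.events ∧ ∃ run, st.runs e.inst.rid = some run ∧ run.spec = e.spec ∧
      run.inst.roles = e.inst.roles := by
  induction h with
  | nil => simp
  | @snoc α st e st' hα hs ih =>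
    intro e' he'
    obtain ⟨rest, hst, hcase⟩ := hs.cases
    have hself : st'.runs e.inst.rid = some ⟨e.spec, e.inst, rest⟩ := by
      rw [hst]; exact State.setRun_self _ _
    rcases List.mem_append.1 he' with he' | he'
    · obtain ⟨h1, run, h2, h3, h4⟩ := ih e' he'
      refine ⟨h1, ?_⟩
      by_cases hr : e'.inst.rid = e.inst.rid
      · rw [hr] at h2 ⊢
        rcases hcase with ⟨R, hR, hi, hcr, hev, hn, _⟩ | ⟨_, inst, hr, hρ, hrun, _⟩
        · simp [hn] at h2
        · rw [hrun] at h2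
          injection h2 with h2
          subst h2
          exact ⟨_, hself, h3, hρ.symm.trans h4⟩
      · exact ⟨run, by rw [hst, State.setRun_of_ne _ hr]; exact h2, h3, h4⟩
    · obtain rfl := List.mem_singleton.1 he'
      refine ⟨?_, _, hself, rfl, rfl⟩
      rcases hcase with ⟨R, hR, hi, hcr, hev, hn, _⟩ | ⟨_, inst, hr, hρ, hrun, _⟩
      · simp [hev]
      · exact (hα.history _ _ hrun).rest _ (by simp)

theorem Reaches.spec_eq {K : Set (RunTerm S)} {Pi : Set (Protocol S)} {α : Trace S} {st : State S}
    (h : Reaches K Pi α st) {e e' : RunEvent S} (he : e ∈ α) (he' : e' ∈ α)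
    (hr : e.inst.rid = e'.inst.rid) : e.spec = e'.spec := by
  obtain ⟨_, run, h1, h2, _⟩ := h.event e he
  obtain ⟨_, run', h1', h2', _⟩ := h.event e' he'
  rw [hr, h1'] at h1
  injection h1 with h1
  rw [← h2, ← h2', h1]

end SecProt

namespace SecProt

variable {S : Signature.{u}}

/-! ### Role specifications of the chaining composition -/

/-- The role specification of the chaining composition for a role with specifications `rs₁` and
`rs₂`. -/
noncomputable abbrev chainSpec (g : S.Label → S.Label) (c d : S.Ident) (rs₁ rs₂ : RoleSpec S) :
    RoleSpec S :=
  (rs₁.seq (rs₂.replace c d)).relabel g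

theorem chain_eq_some {g : S.Label → S.Label} {P Q : Protocol S} {c d : S.Ident} {r : S.Role}
    {rs : RoleSpec S} :
    chain g P Q c d r = some rs ↔
      ∃ rs₁ rs₂, P r = some rs₁ ∧ Q r = some rs₂ ∧ rs = chainSpec g c d rs₁ rs₂ := by
  unfold chain
  cases P r <;> cases Q r <;> simp [eq_comm]

theorem chain_isSome {P Q : Protocol S} (h : ∀ r, (P r).isSome ↔ (Q r).isSome)
    (g : S.Label → S.Label) (c d : S.Ident) (r : S.Role) :
    (chain g P Q c d r).isSome ↔ (P r).isSome := by
  have := h r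
  unfold chain
  cases h₁ : P r <;> cases h₂ : Q r <;> simp_all

theorem chainSpec_events (g : S.Label → S.Label) (c d : S.Ident) (rs₁ rs₂ : RoleSpec S) :
    (chainSpec g c d rs₁ rs₂).events =
      rs₁.events.dropLast.map (Event.map g (RoleTerm.replace c c)) ++
        rs₂.events.tail.map (Event.map g (RoleTerm.replace c d)) := by
  simp only [chainSpec, RoleSpec.seq, RoleSpec.replace, RoleSpec.relabel, List.map_append,
    RoleTerm.replace_self_eq_id, ← List.map_tail, List.map_map]
  congr 2
  funext e
  simp [Event.map_map]

theorem RoleSpec.WellFormed.owner {rs : RoleSpec S} {r : S.Role} (h : rs.WellFormed r)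
    {ev : Event S} (hev : ev ∈ rs.events) : ev.owner = r := by
  obtain ⟨l, l', body, he, hb⟩ := h.shape
  rw [he] at hev
  simp only [List.mem_cons, List.mem_append, List.not_mem_nil, or_false] at hev
  rcases hev with rfl | hev | rfl
  · rfl
  · exact (hb _ hev).2
  · rfl

/-- A specification contains its create event, whose label determines the protocol and whose owner
determines the role. Hence the specification stored in a run event tells which protocol the event
belongs to. -/
theorem IsProtocolSet.spec_unique {Pi : Set (Protocol S)} (h : IsProtocolSet Pi)
    {R R' : Protocol S} {r r' : S.Role} {rs : RoleSpec S} (hR : R ∈ Pi) (hR' : R' ∈ Pi)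
    (hr : R r = some rs) (hr' : R' r' = some rs) : R = R' ∧ r = r' := by
  have h1 := (h.wellFormed R hR).spec _ _ hr
  have h2 := (h.wellFormed R' hR').spec _ _ hr'
  obtain ⟨l, l', body, he, _⟩ := h1.shape
  have hm : Event.create l r ∈ rs.events := by rw [he]; simp
  exact ⟨h.label_unique R hR R' hR' l ⟨_, _, hr, _, hm, rfl⟩ ⟨_, _, hr', _, hm, rfl⟩,
    (h1.owner hm).symm.trans (h2.owner hm)⟩

/-! ### Renaming the constants of one component -/

open Classical in
/-- The permutation of nonces that applies `τ` to the run identifiers of the constants in `I`. -/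
noncomputable def Nonce.shift (I : Set S.Ident) (τ : Equiv.Perm S.RunId) :
    Equiv.Perm (Nonce S) where
  toFun
    | .fresh x rid => .fresh x (if x ∈ I then τ rid else rid)
    | .intruder t => .intruder t
  invFun
    | .fresh x rid => .fresh x (if x ∈ I then τ.symm rid else rid)
    | .intruder t => .intruder t
  left_inv n := by
    cases n with
    | fresh x rid => by_cases h : x ∈ I <;> simp [h]
    | intruder t => rfl
  right_inv n := by
    cases n with
    | fresh x rid => by_cases h : x ∈ I <;> simp [h]
    | intruder t => rfl

theorem Nonce.shift_of_mem {I : Set S.Ident} {τ : Equiv.Perm S.RunId} {x : S.Ident} (h : x ∈ I)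
    (rid : S.RunId) : Nonce.shift I τ (.fresh x rid) = .fresh x (τ rid) := by
  simp [Nonce.shift, h]

theorem Nonce.shift_of_notMem {I : Set S.Ident} {τ : Equiv.Perm S.RunId} {x : S.Ident} (h : x ∉ I)
    (rid : S.RunId) : Nonce.shift I τ (.fresh x rid) = .fresh x rid := by
  simp [Nonce.shift, h]

theorem Nonce.shift_of_fixed (I : Set S.Ident) {τ : Equiv.Perm S.RunId} (x : S.Ident)
    {rid : S.RunId} (h : τ rid = rid) : Nonce.shift I τ (.fresh x rid) = .fresh x rid := by
  by_cases hx : x ∈ I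
  · rw [Nonce.shift_of_mem hx, h]
  · rw [Nonce.shift_of_notMem hx]

theorem Nonce.shift_intruder (I : Set S.Ident) (τ : Equiv.Perm S.RunId) (t : S.Intruder) :
    Nonce.shift I τ (.intruder t) = .intruder t := rfl

/-- There is a permutation that moves the points of `C` out of the finite set `U` and fixes the
other points of `U`. -/
theorem exists_perm_moving {R : Type u} [Infinite R] (U C : Finset R) (hC : C ⊆ U) :
    ∃ τ : Equiv.Perm R, (∀ x ∈ C, τ x ∉ U) ∧ ∀ x ∈ U, x ∉ C → τ x = x := by
  classical
  induction C using Finset.induction_on with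
  | empty => exact ⟨1, by simp, by simp⟩
  | insert a C ha ih =>
    obtain ⟨τ, h1, h2⟩ := ih fun x hx => hC (Finset.mem_insert_of_mem hx)
    -- With `v` outside both `U` and `τ⁻¹(U)`, precomposing with the swap of `a` and `v` sends `a`
    -- to `τ v ∉ U` and changes nothing else on `U`.
    obtain ⟨v, hv⟩ := Infinite.exists_notMem_finset (U ∪ U.image τ.symm)
    simp only [Finset.mem_union, Finset.mem_image, not_or, not_exists, not_and] at hv
    have hτv : τ v ∉ U := fun h => hv.2 _ h (by simp)
    have hne : ∀ x ∈ U, x ≠ v := fun x hx h => hv.1 (h ▸ hx)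
    refine ⟨τ * Equiv.swap a v, ?_, ?_⟩
    · intro x hx
      rcases Finset.mem_insert.1 hx with rfl | hx'
      · simpa using hτv
      · have hxa : x ≠ a := fun h => ha (h ▸ hx')
        simpa [Equiv.swap_apply_of_ne_of_ne hxa (hne x (hC hx))] using h1 x hx'
    · intro x hx hxC
      simp only [Finset.mem_insert, not_or] at hxC
      simpa [Equiv.swap_apply_of_ne_of_ne hxC.1 (hne x hx)] using h2 x hx hxC.2

/-! ### The simulation relation -/

/-- The setting in which a trace of the composed protocol set is split: `U` is the set of run
identifiers in use, `C` holds those of composed runs, and the second half of the composed run `rid`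
is to get the run identifier `τ rid`. -/
structure Splitting (K₀ : Set (RunTerm S)) (P Q : Protocol S) (c d : S.Ident)
    (Pi : Set (Protocol S)) (g : S.Label → S.Label) (τ : Equiv.Perm S.RunId)
    (U C : Set S.RunId) : Prop where
  initial : IsInitialKnowledge K₀
  chainDefined : ChainDefined K₀ P Q c d
  left_notMem : P ∉ Pi
  right_notMem : Q ∉ Pi
  parts : IsProtocolSet ({P, Q} ∪ Pi)
  whole : IsProtocolSet ({chain g P Q c d} ∪ Pi)
  move : ∀ rid ∈ U, rid ∈ C → τ rid ∉ U
  fix : ∀ rid ∈ U, rid ∉ C → τ rid = rid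

section

variable (P Q : Protocol S) (c d : S.Ident) (Pi : Set (Protocol S)) (g : S.Label → S.Label)
  (τ : Equiv.Perm S.RunId) (U C : Set S.RunId)

/-- The view of the instantiation `inst`, with typing `ty`, from a component with typing `ty'`. -/
noncomputable abbrev partInst (d' : S.Ident) (ty ty' : S.Ident → Option IdType) (rid' : S.RunId)
    (inst : Inst S) : Inst S :=
  inst.view (Nonce.shift Q.idents τ) c d' ty ty' rid'

/-- The run event `e'` of the component `X` sees the instantiation of the run event `e` of the
composition. -/
def PartRel (X : Protocol S) (d' : S.Ident) (f : Equiv.Perm S.RunId) (r : S.Role)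
    (e e' : RunEvent S) : Prop :=
  X r = some e'.spec ∧ chain g P Q c d r = some e.spec ∧
    e'.inst = partInst Q c τ d' e.spec.typer e'.spec.typer (f e.inst.rid) e.inst ∧
    Compat (Nonce.shift Q.idents τ) c d' e.spec.typer e'.spec.typer e.inst.rid (f e.inst.rid)

/-- The run event `e` of the composed protocol set corresponds to `e'`. -/
def EventRel (e e' : RunEvent S) : Prop :=
  ((∃ R ∈ Pi, ∃ r, R r = some e.spec) ∧ (¬ ∃ r, chain g P Q c d r = some e.spec) ∧
    e' = ⟨e.spec, partInst Q c τ c e.spec.typer e.spec.typer e.inst.rid e.inst, e.ev⟩) ∨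
  (∃ r, PartRel P Q c d g τ P c 1 r e e' ∧ e'.ev ∈ e'.spec.events ∧
    e.ev = e'.ev.map g (RoleTerm.replace c c)) ∨
  (∃ r, PartRel P Q c d g τ Q d τ r e e' ∧ e'.ev ∈ e'.spec.events ∧
    e.ev = e'.ev.map g (RoleTerm.replace c d))

/-- `β` is a split version of the trace `α` of the composed protocol set. -/
structure TraceSim (α β : Trace S) : Prop where
  matched : ∃ γ : Trace S, List.Forall₂ (EventRel P Q c d Pi g τ) α γ ∧ γ.Sublist β
  left : ∀ e' ∈ β, ∀ r, P r = some e'.spec → ∃ e ∈ α, PartRel P Q c d g τ P c 1 r e e'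
  right : ∀ e' ∈ β, ∀ r, Q r = some e'.spec → ∃ e ∈ α, PartRel P Q c d g τ Q d τ r e e'
  input : ∀ (j : ℕ) e l r, β[j]? = some e → e.ev = .create l r → l ∈ Q.labels →
    ∃ k e' l', j = k + 1 ∧ β[k]? = some e' ∧ e'.ev = .finish l' r ∧ l' ∈ P.labels ∧
      e'.eval (.ident c) = e.eval (.ident d) ∧ e'.inst.roles = e.inst.roles

/-- The run `rid` of the composition still is in its first half. -/
def InLeft (rid : S.RunId) (run : Run S) (runs : S.RunId → Option (Run S)) (r : S.Role)
    (rs₁ rs₂ : RoleSpec S) (rest : List (Event S)) : Prop :=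
  P r = some rs₁ ∧ Q r = some rs₂ ∧ run.spec = chainSpec g c d rs₁ rs₂ ∧
  (∃ l, runs rid =
    some ⟨rs₁, partInst Q c τ c run.spec.typer rs₁.typer rid run.inst, rest ++ [.finish l r]⟩) ∧
  run.rest = rest.map (Event.map g (RoleTerm.replace c c)) ++
    rs₂.events.tail.map (Event.map g (RoleTerm.replace c d)) ∧
  runs (τ rid) = none ∧
  ∀ x, rs₁.typer x = none → ((run.inst.subst x).isSome ↔ run.spec.typer x = some .param)

/-- The run `rid` of the composition is in its second half. -/
def InRight (rid : S.RunId) (run : Run S) (runs : S.RunId → Option (Run S)) (r : S.Role)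
    (rs₁ rs₂ : RoleSpec S) (rest : List (Event S)) : Prop :=
  P r = some rs₁ ∧ Q r = some rs₂ ∧ run.spec = chainSpec g c d rs₁ rs₂ ∧
  runs (τ rid) =
    some ⟨rs₂, partInst Q c τ d run.spec.typer rs₂.typer (τ rid) run.inst, rest⟩ ∧
  run.rest = rest.map (Event.map g (RoleTerm.replace c d)) ∧
  (rs₁.typer c).isSome ∧ (run.inst.value run.spec.typer c).isSome

/-- The run `rid` of the composed protocol set is represented in `runs`. -/
def RunSim (rid : S.RunId) (run : Run S) (runs : S.RunId → Option (Run S)) : Prop :=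
  ((∃ R ∈ Pi, ∃ r, R r = some run.spec) ∧ rid ∉ C ∧ runs rid =
    some ⟨run.spec, partInst Q c τ c run.spec.typer run.spec.typer rid run.inst, run.rest⟩) ∨
  (rid ∈ C ∧ ∃ r rs₁ rs₂ rest, InLeft P Q c d g τ rid run runs r rs₁ rs₂ rest) ∨
  (rid ∈ C ∧ ∃ r rs₁ rs₂ rest, InRight P Q c d g τ rid run runs r rs₁ rs₂ rest)

/-- The state `sb` represents the state `st` of the composed protocol set. -/
structure StateSim (st sb : State S) : Prop where
  knowledge : sb.knowledge = RunTerm.rename (Nonce.shift Q.idents τ) '' st.knowledge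
  runs : ∀ rid run, st.runs rid = some run → RunSim P Q c d Pi g τ C rid run sb.runs
  fresh : ∀ y, sb.runs y ≠ none → ∃ rid, st.runs rid ≠ none ∧ (y = rid ∨ y = τ rid)
  used : ∀ rid run, st.runs rid = some run →
    rid ∈ U ∧ (rid ∈ C ↔ ∃ r, chain g P Q c d r = some run.spec)

end

variable {P Q : Protocol S} {c d : S.Ident} {Pi : Set (Protocol S)}
  {g : S.Label → S.Label} {τ : Equiv.Perm S.RunId} {C : Set S.RunId}

theorem left_mem_parts : P ∈ ({P, Q} ∪ Pi : Set (Protocol S)) := by simp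

theorem right_mem_parts : Q ∈ ({P, Q} ∪ Pi : Set (Protocol S)) := by simp

theorem chain_mem_whole :
    chain g P Q c d ∈ ({chain g P Q c d} ∪ Pi : Set (Protocol S)) := by simp

theorem RunSim.congr {rid : S.RunId} {run : Run S} {f f' : S.RunId → Option (Run S)}
    (h : RunSim P Q c d Pi g τ C rid run f) (h1 : f' rid = f rid)
    (h2 : f' (τ rid) = f (τ rid)) : RunSim P Q c d Pi g τ C rid run f' := by
  unfold RunSim InLeft InRight
  rw [h1, h2]
  exact h

end SecProt

/-! ### Compatibility of typings, and the invariants of the simulation -/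

namespace SecProt

variable {S : Signature.{u}}

theorem left_typer {g : S.Label → S.Label} {c d x : S.Ident} {rs₁ : RoleSpec S} (rs₂ : RoleSpec S)
    (h : (rs₁.typer x).isSome) : (chainSpec g c d rs₁ rs₂).typer x = rs₁.typer x := by
  obtain ⟨k, hk⟩ := Option.isSome_iff_exists.1 h
  simp [RoleSpec.relabel, RoleSpec.seq, hk]

theorem right_typer {g : S.Label → S.Label} {c d x : S.Ident} {rs₁ rs₂ : RoleSpec S}
    (h : rs₁.typer x = none) (hc : x ≠ c) (hd : x ≠ d) :
    (chainSpec g c d rs₁ rs₂).typer x = rs₂.typer x := by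
  simp [RoleSpec.relabel, RoleSpec.seq, RoleSpec.replace, h, hc, hd]

variable {K₀ : Set (RunTerm S)} {P Q : Protocol S} {c d : S.Ident} {Pi : Set (Protocol S)}
  {g : S.Label → S.Label} {τ : Equiv.Perm S.RunId} {U C : Set S.RunId}

theorem IsInitialRun.view {R R' : Protocol S} {rs rs' : RoleSpec S} {inst : Inst S}
    {θ : Equiv.Perm (Nonce S)} {rid' : S.RunId} {r : S.Role}
    (h : IsInitialRun R rs inst) (hs : R' r = some rs') (hR : ∀ r, (R r).isSome ↔ (R' r).isSome)
    (H : Compat θ c c rs.typer rs'.typer inst.rid rid') :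
    IsInitialRun R' rs' (inst.view θ c c rs.typer rs'.typer rid') := by
  classical
  refine ⟨⟨r, hs⟩, fun r => (h.2.1 r).trans (hR r), fun x => ?_⟩
  have h1 : (if x = c then c else x) = x := by split_ifs with h <;> simp [h]
  have h2 := h.2.2 x
  simp only [Inst.view, h1]
  split_ifs with h3
  · have h4 : rs.typer x = rs'.typer x := H.agree x (by rcases h3 with h | h <;> simp [h]) fun _ => rfl
    rw [Option.isSome_map, Inst.value, h4]
    rw [h4] at h2
    rcases h3 with h | h <;> simpa [h] using h2
  · simp only [Option.isSome_none, Bool.false_eq_true, false_iff]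
    exact fun h => h3 (.inl h)

namespace Splitting

section Static

variable (H : Splitting K₀ P Q c d Pi g τ U C)
include H

theorem mem_idents_right {r : S.Role} {rs : RoleSpec S} (h : Q r = some rs) : d ∈ Q.idents :=
  ⟨r, rs, h, by simp [H.chainDefined.isParam r rs h]⟩

theorem notMem_right {x : S.Ident} {r : S.Role} {rs : RoleSpec S} (h : P r = some rs)
    (hx : (rs.typer x).isSome) : x ∉ Q.idents :=
  fun hq => Set.disjoint_left.1 H.chainDefined.disjoint ⟨r, rs, h, hx⟩ hq

theorem left_typer_eq_none {x : S.Ident} {r r' : S.Role} {rs₁ rs₂ : RoleSpec S}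
    (h : P r = some rs₁) (h' : Q r' = some rs₂) (hx : (rs₂.typer x).isSome) :
    rs₁.typer x = none := by
  by_contra hne
  exact H.notMem_right h (Option.isSome_iff_ne_none.2 hne) ⟨r', rs₂, h', hx⟩

theorem left_ne_right {r : S.Role} {rs : RoleSpec S} (h : Q r = some rs) : P ≠ Q := by
  rintro rfl
  have := H.mem_idents_right h
  exact Set.disjoint_left.1 H.chainDefined.disjoint this this

/-- Such a run may share identifiers with `Q`; its constants stay put because `τ` fixes its run
identifier. -/
theorem compat_self {rid : S.RunId} (hU : rid ∈ U) (hC : rid ∉ C) (ty : S.Ident → Option IdType) :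
    Compat (Nonce.shift Q.idents τ) c c ty ty rid rid where
  agree _ _ _ := rfl
  const x _ := Nonce.shift_of_fixed _ x (H.fix rid hU hC)
  input := .inl rfl

/-- Here `τ` may move the run identifier, but no constant of `P` is an identifier of `Q`. -/
theorem compat_left {r : S.Role} {rs₁ : RoleSpec S} (rs₂ : RoleSpec S) (h : P r = some rs₁)
    (rid : S.RunId) :
    Compat (Nonce.shift Q.idents τ) c c (chainSpec g c d rs₁ rs₂).typer rs₁.typer rid rid where
  agree _ hx _ := left_typer rs₂ hx
  const x hx := Nonce.shift_of_notMem (H.notMem_right h (by simp [hx])) rid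
  input := .inl rfl

/-- Constants of `Q` move along with the run identifier. Since `P` types `c`, disjointness keeps `c`
out of `Q`, so replacing `d` by `c` cannot collide with another identifier of `Q`. -/
theorem compat_right {r : S.Role} {rs₁ rs₂ : RoleSpec S} (h₁ : P r = some rs₁)
    (h₂ : Q r = some rs₂) (hc : (rs₁.typer c).isSome) (rid : S.RunId) :
    Compat (Nonce.shift Q.idents τ) c d (chainSpec g c d rs₁ rs₂).typer rs₂.typer rid (τ rid) where
  agree x hx hxd := by
    have h0 : ∀ y, (rs₂.typer y).isSome → y ≠ c := by
      rintro y hy rfl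
      simp [H.left_typer_eq_none h₁ h₂ hy] at hc
    have hd : d ≠ c := h0 d (by simp [H.chainDefined.isParam r rs₂ h₂])
    exact right_typer (H.left_typer_eq_none h₁ h₂ hx) (h0 x hx) fun h => hd (hxd h)
  const x hx := Nonce.shift_of_mem (show x ∈ Q.idents from ⟨r, rs₂, h₂, by simp [hx]⟩) rid
  input := by
    refine .inr ⟨?_, H.chainDefined.isParam r rs₂ h₂⟩
    by_contra hne
    have := H.left_typer_eq_none h₁ h₂ (Option.isSome_iff_ne_none.2 hne)
    simp [this] at hc

/-! ### Extending the split trace -/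

/-- Create events of `Q` are excluded because they must directly follow an end event of `P`; they
enter only through `traceSim_cross`. -/
theorem traceSim_push {α β : Trace S} {e e' : RunEvent S} (h : TraceSim P Q c d Pi g τ α β)
    (he : EventRel P Q c d Pi g τ e e')
    (hcr : ∀ l r, e'.ev = .create l r → l ∉ Q.labels) :
    TraceSim P Q c d Pi g τ (α ++ [e]) (β ++ [e']) where
  matched := by
    obtain ⟨γ, h1, h2⟩ := h.matched
    exact ⟨γ ++ [e'], List.rel_append h1 (.cons he .nil), h2.append (.refl _)⟩
  left := by
    intro e₁ he₁ r hr
    rcases List.mem_append.1 he₁ with he₁ | he₁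
    · obtain ⟨e₀, h1, h2⟩ := h.left e₁ he₁ r hr
      exact ⟨e₀, by simp [h1], h2⟩
    · obtain rfl := List.mem_singleton.1 he₁
      refine ⟨e, by simp, ?_⟩
      rcases he with ⟨⟨R, hR, r', hr'⟩, _, rfl⟩ | ⟨r', h1, _⟩ | ⟨r', h1, _⟩
      · obtain ⟨rfl, _⟩ := H.parts.spec_unique (.inr hR) left_mem_parts hr' hr
        exact absurd hR H.left_notMem
      · obtain ⟨_, rfl⟩ := H.parts.spec_unique left_mem_parts left_mem_parts h1.1 hr
        exact h1
      · exact absurd (H.parts.spec_unique left_mem_parts right_mem_parts hr h1.1).1 (H.left_ne_right h1.1)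
  right := by
    intro e₁ he₁ r hr
    rcases List.mem_append.1 he₁ with he₁ | he₁
    · obtain ⟨e₀, h1, h2⟩ := h.right e₁ he₁ r hr
      exact ⟨e₀, by simp [h1], h2⟩
    · obtain rfl := List.mem_singleton.1 he₁
      refine ⟨e, by simp, ?_⟩
      rcases he with ⟨⟨R, hR, r', hr'⟩, _, rfl⟩ | ⟨r', h1, _⟩ | ⟨r', h1, _⟩
      · obtain ⟨rfl, _⟩ := H.parts.spec_unique (.inr hR) right_mem_parts hr' hr
        exact absurd hR H.right_notMem
      · exact absurd (H.parts.spec_unique left_mem_parts right_mem_parts h1.1 hr).1 (H.left_ne_right hr)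
      · obtain ⟨_, rfl⟩ := H.parts.spec_unique right_mem_parts right_mem_parts h1.1 hr
        exact h1
  input := by
    intro j e₁ l r hj hev hl
    rw [List.getElem?_append] at hj
    split_ifs at hj with hlt
    · obtain ⟨k, e₂, l', rfl, hk, h2⟩ := h.input j e₁ l r hj hev hl
      exact ⟨k, e₂, l', rfl, by rw [List.getElem?_append_left (by omega)]; exact hk, h2⟩
    · obtain rfl := List.mem_singleton.1 (List.mem_of_getElem? hj)
      exact absurd hl (hcr l r hev)

/-- The inserted pair matches no event of `α`, so the embedded subsequence is unchanged. Both new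
events still see the instantiation of an existing event `e` of the composed run, and this is all
that the component conditions ask for. -/
theorem traceSim_cross {α β : Trace S} {e e₁ e₂ : RunEvent S} {r : S.Role} {l l' : S.Label}
    (h : TraceSim P Q c d Pi g τ α β) (he : e ∈ α)
    (h₁ : PartRel P Q c d g τ P c 1 r e e₁) (h₂ : PartRel P Q c d g τ Q d τ r e e₂)
    (hl : l ∈ P.labels) (hev₁ : e₁.ev = .finish l r) (hev₂ : e₂.ev = .create l' r)
    (hval : e₁.eval (.ident c) = e₂.eval (.ident d)) :
    TraceSim P Q c d Pi g τ α (β ++ [e₁] ++ [e₂]) where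
  matched := by
    obtain ⟨γ, h1, h2⟩ := h.matched
    exact ⟨γ, h1, h2.trans (by simp)⟩
  left := by
    intro e' he' r' hr'
    simp only [List.mem_append, List.mem_singleton] at he'
    rcases he' with (he' | rfl) | rfl
    · exact h.left _ he' _ hr'
    · obtain ⟨_, rfl⟩ := H.parts.spec_unique left_mem_parts left_mem_parts h₁.1 hr'
      exact ⟨e, he, h₁⟩
    · exact absurd (H.parts.spec_unique left_mem_parts right_mem_parts hr' h₂.1).1 (H.left_ne_right h₂.1)
  right := by
    intro e' he' r' hr'
    simp only [List.mem_append, List.mem_singleton] at he'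
    rcases he' with (he' | rfl) | rfl
    · exact h.right _ he' _ hr'
    · exact absurd (H.parts.spec_unique left_mem_parts right_mem_parts h₁.1 hr').1 (H.left_ne_right h₂.1)
    · obtain ⟨_, rfl⟩ := H.parts.spec_unique right_mem_parts right_mem_parts h₂.1 hr'
      exact ⟨e, he, h₂⟩
  input := by
    intro j e' l₀ r₀ hj hev hl₀
    rw [List.getElem?_append] at hj
    split_ifs at hj with hlt
    · rw [List.getElem?_append] at hj
      split_ifs at hj with hlt
      · obtain ⟨k, e₃, l₃, rfl, hk, h3⟩ := h.input j e' l₀ r₀ hj hev hl₀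
        refine ⟨k, e₃, l₃, rfl, ?_, h3⟩
        rw [List.append_assoc, List.getElem?_append_left (by omega)]; exact hk
      · obtain rfl := List.mem_singleton.1 (List.mem_of_getElem? hj)
        simp [hev₁] at hev
    · have hmem := List.mem_of_getElem? hj
      obtain rfl := List.mem_singleton.1 hmem
      rw [hev₂] at hev
      injection hev with _ hr
      subst hr
      have hlen : j = β.length + 1 := by
        have := (List.getElem?_eq_some_iff.1 hj).1
        simp at this hlt
        omega
      exact ⟨β.length, e₁, l, hlen, by simp, hev₁, hl, hval,
        by rw [h₁.2.2.1, h₂.2.2.1]; rfl⟩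

/-! ### Updating the states -/

/-- The pairs `{rid, τ rid}` of distinct used identifiers are disjoint, since `τ` moves composed
runs outside `U` and fixes the others in `U`. An update for one composed run therefore leaves the
representation of all others intact. -/
theorem stateSim_update {st st' sb sb' : State S} {run : Run S} (rid : S.RunId)
    (h : StateSim P Q c d Pi g τ U C st sb) (hrid : run.inst.rid = rid)
    (hst : st'.runs = st.setRun run)
    (hsb : ∀ y, y ≠ rid → y ≠ τ rid → sb'.runs y = sb.runs y)
    (hK : sb'.knowledge = RunTerm.rename (Nonce.shift Q.idents τ) '' st'.knowledge)
    (hU : rid ∈ U) (hC : rid ∈ C ↔ ∃ r, chain g P Q c d r = some run.spec)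
    (hrun : RunSim P Q c d Pi g τ C rid run sb'.runs) :
    StateSim P Q c d Pi g τ U C st' sb' where
  knowledge := hK
  runs := by
    intro rid₂ run₂ h₂
    rw [hst] at h₂
    rcases State.setRun_cases h₂ with ⟨rfl, rfl⟩ | ⟨hne, h₂⟩
    · rwa [hrid]
    · rw [hrid] at hne
      have hU₂ := (h.used _ _ h₂).1
      have h1 : ∀ a b, a ∈ U → b ∈ U → a ≠ b → a ≠ τ b := by
        rintro a b ha hb hab rfl
        by_cases hbC : b ∈ C
        · exact H.move b hb hbC ha
        · exact hab (H.fix b hb hbC)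
      exact (h.runs _ _ h₂).congr (hsb _ hne (h1 _ _ hU₂ hU hne))
        (hsb _ (h1 _ _ hU hU₂ hne.symm).symm fun h => hne (τ.injective h))
  fresh := by
    intro y hy
    by_cases h1 : y = rid ∨ y = τ rid
    · exact ⟨rid, by rw [hst, ← hrid, State.setRun_self]; simp, h1⟩
    · push Not at h1
      rw [hsb y h1.1 h1.2] at hy
      obtain ⟨z, hz, hyz⟩ := h.fresh y hy
      refine ⟨z, ?_, hyz⟩
      rw [hst]
      by_cases hzr : z = run.inst.rid
      · rw [hzr, State.setRun_self]; simp
      · rwa [State.setRun_of_ne _ hzr]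
  used := by
    intro rid₂ run₂ h₂
    rw [hst] at h₂
    rcases State.setRun_cases h₂ with ⟨rfl, rfl⟩ | ⟨hne, h₂⟩
    · rw [hrid]; exact ⟨hU, hC⟩
    · exact h.used _ _ h₂

theorem stateSim_unused {st sb : State S} {rid : S.RunId} (h : StateSim P Q c d Pi g τ U C st sb)
    (hU : rid ∈ U) (hn : st.runs rid = none) : sb.runs rid = none ∧ sb.runs (τ rid) = none := by
  have key : ∀ y, (y = rid ∨ y = τ rid) → sb.runs y = none := by
    intro y hy
    by_contra hne
    obtain ⟨z, hz, hyz⟩ := h.fresh y hne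
    obtain ⟨run, hrun⟩ := Option.ne_none_iff_exists'.1 hz
    have hzU := (h.used _ _ hrun).1
    have hzr : z ≠ rid := fun h => by rw [h] at hz; exact hz hn
    rcases hy with rfl | rfl <;> rcases hyz with h1 | h1
    · exact hzr h1.symm
    · by_cases hzC : z ∈ C
      · exact H.move z hzU hzC (h1 ▸ hU)
      · exact hzr ((H.fix z hzU hzC).symm.trans h1.symm)
    · by_cases hC : rid ∈ C
      · exact H.move rid hU hC (h1 ▸ hzU)
      · exact hzr (h1.symm.trans (H.fix rid hU hC))
    · exact hzr (τ.injective h1).symm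
  exact ⟨key _ (.inl rfl), key _ (.inr rfl)⟩

end Static
end Splitting
end SecProt

/-! ### Simulating one step of the composition -/

namespace SecProt

variable {S : Signature.{u}} {K₀ : Set (RunTerm S)} {P Q : Protocol S} {c d : S.Ident}
  {Pi : Set (Protocol S)} {g : S.Label → S.Label} {τ : Equiv.Perm S.RunId} {U C : Set S.RunId}
  {α β : Trace S} {st st' sb : State S} {e : RunEvent S}

theorem chainSpec_events_of_shape {r : S.Role} {rs₁ : RoleSpec S} (h₁ : rs₁.WellFormed r)
    (g : S.Label → S.Label) (c d : S.Ident) (rs₂ : RoleSpec S) :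
    ∃ l l' body, rs₁.events = .create l r :: (body ++ [.finish l' r]) ∧
      (chainSpec g c d rs₁ rs₂).events = .create (g l) r ::
        (body.map (Event.map g (RoleTerm.replace c c)) ++
          rs₂.events.tail.map (Event.map g (RoleTerm.replace c d))) := by
  obtain ⟨l, l', body, he, _⟩ := h₁.shape
  refine ⟨l, l', body, he, ?_⟩
  have : rs₁.events.dropLast = .create l r :: body := by
    rw [he, ← List.cons_append, List.dropLast_concat]
  rw [chainSpec_events, this]
  rfl

namespace Splitting

variable (H : Splitting K₀ P Q c d Pi g τ U C)
include H

theorem label_notMem_right {R : Protocol S} (hR : R ∈ ({P, Q} ∪ Pi : Set (Protocol S)))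
    (hne : R ≠ Q) {r : S.Role} {rs : RoleSpec S} (hr : R r = some rs) {ev : Event S}
    (hev : ev ∈ rs.events) : ev.label ∉ Q.labels :=
  fun h => hne (H.parts.label_unique R hR Q right_mem_parts _ ⟨r, rs, hr, ev, hev, rfl⟩ h)

theorem step_right {run : Run S} {r : S.Role} {rs₁ rs₂ : RoleSpec S} {rest : List (Event S)}
    (hβ : Reaches K₀ ({P, Q} ∪ Pi) β sb) (hT : TraceSim P Q c d Pi g τ α β)
    (hS : StateSim P Q c d Pi g τ U C st sb) (hs : Step ({chain g P Q c d} ∪ Pi) st e st')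
    (hU : e.inst.rid ∈ U) (hC : e.inst.rid ∈ C) (hrun : st.runs e.inst.rid = some run)
    (hin : InRight P Q c d g τ e.inst.rid run sb.runs r rs₁ rs₂ rest) :
    ∃ β' sb', Reaches K₀ ({P, Q} ∪ Pi) β' sb' ∧ TraceSim P Q c d Pi g τ (α ++ [e]) β' ∧
      StateSim P Q c d Pi g τ U C st' sb' := by
  obtain ⟨hP, hQ, hspec, hrunb, hrest, hc, hval⟩ := hin
  obtain ⟨rest₀, hst, ⟨_, _, _, _, _, hn, _⟩ | ⟨hncr, inst, hr, hρ, hrun', hdom, hmono⟩⟩ := hs.cases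
  · simp [hn] at hrun
  rw [hrun] at hrun'
  injection hrun' with hrun'
  subst hrun'
  obtain ⟨ev, rest, rfl, hev, hrest⟩ := List.map_eq_cons_iff.1 hrest.symm
  have hcompat : Compat (Nonce.shift Q.idents τ) c d e.spec.typer rs₂.typer e.inst.rid
      (τ e.inst.rid) := by
    rw [show e.spec = _ from hspec]; exact H.compat_right hP hQ hc _
  have hmem : ev ∈ rs₂.events := (hβ.history _ _ hrunb).rest ev (by simp)
  obtain ⟨sb', hstep, hK, hsb'⟩ := hs.view (Pi' := {P, Q} ∪ Pi) (rest := rest₀)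
    (by rw [hrun, hev]) hrunb hS.knowledge hcompat
    (((H.parts.wellFormed Q right_mem_parts).spec r rs₂ hQ).typed ev hmem)
    (fun h => by simpa [h] using hrest) (.inr hval)
  refine ⟨_, sb', hβ.snoc hstep, H.traceSim_push hT
    (.inr (.inr ⟨r, ⟨hQ, chain_eq_some.2 ⟨_, _, hP, hQ, hspec⟩, rfl, hcompat⟩, hmem, hev.symm⟩)) ?_,
    H.stateSim_update e.inst.rid hS rfl hst ?_ hK hU
      ⟨fun _ => ⟨r, chain_eq_some.2 ⟨_, _, hP, hQ, hspec⟩⟩, fun _ => hC⟩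
      (.inr (.inr ⟨hC, r, rs₁, rs₂, rest, hP, hQ, hspec, ?_, hrest.symm, hc, ?_⟩))⟩
  · rintro l r' h _
    simp only at h
    rw [h] at hev
    exact hncr _ _ hev.symm
  · intro y _ hy
    rw [hsb']
    exact State.setRun_of_ne _ hy
  · rw [hsb']
    exact State.setRun_self sb ⟨rs₂, partInst Q c τ d e.spec.typer rs₂.typer _ e.inst, rest⟩
  · obtain ⟨n, hn⟩ := Option.isSome_iff_exists.1 hval
    exact Option.isSome_iff_exists.2 ⟨n, Inst.value_mono hr.symm hmono hn⟩

theorem step_left {run : Run S} {r : S.Role} {rs₁ rs₂ : RoleSpec S} {ev : Event S}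
    {rest : List (Event S)}
    (hβ : Reaches K₀ ({P, Q} ∪ Pi) β sb) (hT : TraceSim P Q c d Pi g τ α β)
    (hS : StateSim P Q c d Pi g τ U C st sb) (hs : Step ({chain g P Q c d} ∪ Pi) st e st')
    (hU : e.inst.rid ∈ U) (hC : e.inst.rid ∈ C) (hrun : st.runs e.inst.rid = some run)
    (hin : InLeft P Q c d g τ e.inst.rid run sb.runs r rs₁ rs₂ (ev :: rest)) :
    ∃ β' sb', Reaches K₀ ({P, Q} ∪ Pi) β' sb' ∧ TraceSim P Q c d Pi g τ (α ++ [e]) β' ∧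
      StateSim P Q c d Pi g τ U C st' sb' := by
  obtain ⟨hP, hQ, hspec, ⟨lf, hrunb⟩, hrest, hnone, hdom₀⟩ := hin
  obtain ⟨rest₀, hst, ⟨_, _, _, _, _, hn, _⟩ | ⟨hncr, inst, hr, hρ, hrun', hdom, hmono⟩⟩ := hs.cases
  · simp [hn] at hrun
  rw [hrun] at hrun'
  injection hrun' with hrun'
  subst hrun'
  simp only [List.map_cons, List.cons_append, List.cons.injEq] at hrest
  obtain ⟨hev, hrest⟩ := hrest
  have hcompat : Compat (Nonce.shift Q.idents τ) c c e.spec.typer rs₁.typer e.inst.rid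
      e.inst.rid := by
    rw [show e.spec = _ from hspec]; exact H.compat_left rs₂ hP _
  have hmem : ev ∈ rs₁.events := (hβ.history _ _ hrunb).rest ev (by simp)
  have htyped := ((H.parts.wellFormed P left_mem_parts).spec r rs₁ hP).typed ev hmem
  -- The second half contains at least the end event of `Q`, so a run in its first half is never
  -- exhausted by this step.
  have htail : rs₂.events.tail ≠ [] := by
    obtain ⟨l, l', body, he, _⟩ := ((H.parts.wellFormed Q right_mem_parts).spec r rs₂ hQ).shape
    simp [he]
  obtain ⟨sb', hstep, hK, hsb'⟩ := hs.view (Pi' := {P, Q} ∪ Pi) (rest := rest₀)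
    (by rw [hrun, hev]) hrunb hS.knowledge hcompat htyped
    (fun h => absurd (List.map_eq_nil_iff.1
      (List.append_eq_nil_iff.1 (hrest.symm.trans h)).2) htail) (.inl rfl)
  have hself := State.setRun_self sb
    ⟨rs₁, partInst Q c τ c e.spec.typer rs₁.typer e.inst.rid e.inst, rest ++ [.finish lf r]⟩
  refine ⟨_, sb', hβ.snoc hstep, H.traceSim_push hT
    (.inr (.inl ⟨r, ⟨hP, chain_eq_some.2 ⟨_, _, hP, hQ, hspec⟩, rfl, hcompat⟩, hmem, hev⟩)) ?_,
    H.stateSim_update e.inst.rid hS rfl hst ?_ hK hU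
      ⟨fun _ => ⟨r, chain_eq_some.2 ⟨_, _, hP, hQ, hspec⟩⟩, fun _ => hC⟩
      (.inr (.inl ⟨hC, r, rs₁, rs₂, rest, hP, hQ, hspec, ⟨lf, ?_⟩, hrest, ?_, ?_⟩))⟩
  · rintro l r' h _
    simp only at h
    rw [h] at hev
    exact hncr _ _ hev
  · intro y hy _
    rw [hsb']
    exact State.setRun_of_ne _ hy
  · rw [hsb']
    exact hself
  · rw [hsb']
    refine (State.setRun_of_ne _ ?_).trans hnone
    exact fun h => H.move _ hU hC (by rw [h]; exact hU)
  · intro x hx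
    refine Iff.trans ⟨fun h => (hdom x h).resolve_right ?_, fun h => ?_⟩ (hdom₀ x hx)
    -- Events of `P` mention only identifiers typed by `P`, so they bind none of the identifiers
    -- this invariant speaks of.
    · rintro ⟨hxi, -⟩
      rw [hev, RoleTerm.replace_self_eq_id] at hxi
      have : x ∈ ev.idents := by cases ev <;> simp_all [Event.map, Event.idents]
      simpa [hx] using htyped x this
    · obtain ⟨n, hn⟩ := Option.isSome_iff_exists.1 h
      exact Option.isSome_iff_exists.2 ⟨n, hmono x n hn⟩

/-- The composition does not move here; only the split trace advances, by the end of the `P` run and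
the creation of the `Q` run. The latter is a legitimate initial run: `d` takes the value of `c`, and
on the other identifiers of `Q` the composed run has so far bound exactly the parameters. -/
theorem cross {rid : S.RunId} {run : Run S} {r : S.Role} {rs₁ rs₂ : RoleSpec S}
    (hα : Reaches K₀ ({chain g P Q c d} ∪ Pi) α st)
    (hβ : Reaches K₀ ({P, Q} ∪ Pi) β sb) (hT : TraceSim P Q c d Pi g τ α β)
    (hS : StateSim P Q c d Pi g τ U C st sb)
    (hC : rid ∈ C) (hrun : st.runs rid = some run)
    (hin : InLeft P Q c d g τ rid run sb.runs r rs₁ rs₂ []) :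
    ∃ β' sb', Reaches K₀ ({P, Q} ∪ Pi) β' sb' ∧ TraceSim P Q c d Pi g τ α β' ∧
      StateSim P Q c d Pi g τ U C st sb' ∧
      InRight P Q c d g τ rid run sb'.runs r rs₁ rs₂ rs₂.events.tail := by
  obtain ⟨hP, hQ, hspec, ⟨lf, hrunb⟩, hrest, hnone, hdom₀⟩ := hin
  have hhist := hα.history _ _ hrun
  obtain ⟨e₀, he₀, hspec₀, hinst₀⟩ := hhist.last
  obtain ⟨hU, hCiff⟩ := hS.used _ _ hrun
  have hne : τ rid ≠ rid := fun h => H.move _ hU hC (by rwa [h])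
  set i₁ := partInst Q c τ c run.spec.typer rs₁.typer rid run.inst with hi₁
  set i₂ := partInst Q c τ d run.spec.typer rs₂.typer (τ rid) run.inst with hi₂
  have hmem : Event.finish lf r ∈ rs₁.events := (hβ.history _ _ hrunb).rest _ (by simp)
  have hlf : lf ∈ P.labels := ⟨r, rs₁, hP, _, hmem, rfl⟩
  have hstep₁ : Step ({P, Q} ∪ Pi) sb ⟨rs₁, i₁, .finish lf r⟩ _ := .finish hrunb
  have hβ₁ := hβ.snoc hstep₁
  -- The assumption on `c` is applied to the split trace extended by the end event, which is a trace
  -- of a protocol set containing `P`.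
  have hest := H.chainDefined.establishes _ H.parts left_mem_parts _ ⟨_, hβ₁⟩
    ⟨rs₁, i₁, .finish lf r⟩ (by simp) lf r rfl hlf
  have hc : (rs₁.typer c).isSome := Inst.typed_of_eval hest c rfl
  have hcompat₁ : Compat (Nonce.shift Q.idents τ) c c run.spec.typer rs₁.typer run.inst.rid
      rid := by
    rw [hspec, hhist.rid_eq]; exact H.compat_left rs₂ hP _
  have hcompat₂ : Compat (Nonce.shift Q.idents τ) c d run.spec.typer rs₂.typer run.inst.rid
      (τ rid) := by
    rw [hspec, hhist.rid_eq]; exact H.compat_right hP hQ hc _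
  have hv₁ : i₁.value rs₁.typer c =
      (run.inst.value run.spec.typer c).map (Nonce.shift Q.idents τ) := by
    rw [hi₁, hcompat₁.value_view hc]; simp
  have hd : rs₂.typer d = some .param := H.chainDefined.isParam r rs₂ hQ
  have hv₂ : i₂.value rs₂.typer d =
      (run.inst.value run.spec.typer c).map (Nonce.shift Q.idents τ) := by
    rw [hi₂, hcompat₂.value_view (by simp [hd])]; simp
  have hval : (run.inst.value run.spec.typer c).isSome := by
    have : (i₁.eval rs₁.typer (.ident c)).isSome := hest
    rwa [Inst.eval_ident, Option.isSome_map, hv₁, Option.isSome_map] at this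
  obtain ⟨lc, lf', body, hev₂, _⟩ := ((H.parts.wellFormed Q right_mem_parts).spec r rs₂ hQ).shape
  have hchain := chain_eq_some.2 ⟨_, _, hP, hQ, hspec⟩
  have hinit : IsInitialRun Q rs₂ i₂ := by
    classical
    refine ⟨⟨r, hQ⟩, fun r' => ?_, fun x => ?_⟩
    · obtain ⟨R, hR, ⟨r₀, hr₀⟩, hroles⟩ := hhist.spec
      obtain ⟨rfl, -⟩ := H.whole.spec_unique hR chain_mem_whole hr₀ hchain
      exact (hroles r').trans
        ((chain_isSome H.chainDefined.sameRoles g c d r').trans (H.chainDefined.sameRoles r'))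
    · simp only [hi₂, partInst, Inst.view]
      split_ifs with h₁ h₂
      · subst h₂
        simp [hval, hd]
      · have hs : (rs₂.typer x).isSome := by rcases h₁ with h | h <;> simp [h]
        have hag := hcompat₂.agree x hs fun h => absurd h h₂
        have := hdom₀ x (H.left_typer_eq_none hP hQ hs)
        rw [Option.isSome_map, Inst.value, hag]
        rw [hag] at this
        rcases h₁ with h | h <;> simpa [h] using this
      · simp only [Option.isSome_none, Bool.false_eq_true, false_iff]
        exact fun h => h₁ (.inl h)
  have hstep₂ : Step ({P, Q} ∪ Pi) _ ⟨rs₂, i₂, .create lc r⟩ _ :=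
    .create (st := ⟨sb.knowledge, sb.setRun ⟨rs₁, i₁, []⟩⟩) right_mem_parts hinit hev₂
      ((State.setRun_of_ne _ hne).trans hnone)
  have hright : InRight P Q c d g τ rid run
      (State.setRun ⟨sb.knowledge, sb.setRun ⟨rs₁, i₁, []⟩⟩
        ⟨rs₂, i₂, body ++ [.finish lf' r]⟩) r rs₁ rs₂ rs₂.events.tail := by
    refine ⟨hP, hQ, hspec, ?_, hrest, hc, hval⟩
    rw [hev₂]
    exact State.setRun_self _ ⟨rs₂, i₂, body ++ [.finish lf' r]⟩
  refine ⟨_, _, hβ₁.snoc hstep₂, H.traceSim_cross (l := lf) (l' := lc) (r := r) hT he₀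
    ⟨hP, by rw [hspec₀]; exact hchain, by rw [hspec₀, hinst₀, hhist.rid_eq]; rfl,
      by rw [hspec₀, hinst₀, hhist.rid_eq]; rw [hhist.rid_eq] at hcompat₁; exact hcompat₁⟩
    ⟨hQ, by rw [hspec₀]; exact hchain, by rw [hspec₀, hinst₀, hhist.rid_eq],
      by rw [hspec₀, hinst₀, hhist.rid_eq]; rw [hhist.rid_eq] at hcompat₂; exact hcompat₂⟩
    hlf rfl rfl ?_, ?_, ?_⟩
  · change i₁.eval rs₁.typer _ = i₂.eval rs₂.typer _
    rw [Inst.eval_ident, Inst.eval_ident, hv₁, hv₂]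
  -- The composed state is regarded as updated at `rid` by the run it already holds.
  · refine H.stateSim_update rid hS hhist.rid_eq ?_ ?_ hS.knowledge hU hCiff
      (.inr (.inr ⟨hC, r, rs₁, rs₂, _, hright⟩))
    · funext y
      by_cases hy : y = rid
      · rw [hy, hrun, ← hhist.rid_eq, State.setRun_self]
      · rw [State.setRun_of_ne]
        rwa [hhist.rid_eq]
    · intro y h₁ h₂
      exact (State.setRun_of_ne _ h₂).trans (State.setRun_of_ne _ h₁)
  · exact hright

theorem step_other {run : Run S}
    (hβ : Reaches K₀ ({P, Q} ∪ Pi) β sb) (hT : TraceSim P Q c d Pi g τ α β)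
    (hS : StateSim P Q c d Pi g τ U C st sb) (hs : Step ({chain g P Q c d} ∪ Pi) st e st')
    (hU : e.inst.rid ∈ U) (hC : e.inst.rid ∉ C) (hnc : ¬ ∃ r, chain g P Q c d r = some e.spec)
    (hrun : st.runs e.inst.rid = some run) (hPi : ∃ R ∈ Pi, ∃ r, R r = some run.spec)
    (hrunb : sb.runs e.inst.rid = some ⟨run.spec,
      partInst Q c τ c run.spec.typer run.spec.typer e.inst.rid run.inst, run.rest⟩) :
    ∃ β' sb', Reaches K₀ ({P, Q} ∪ Pi) β' sb' ∧ TraceSim P Q c d Pi g τ (α ++ [e]) β' ∧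
      StateSim P Q c d Pi g τ U C st' sb' := by
  obtain ⟨rest₀, hst, ⟨_, _, _, _, _, hn, _⟩ | ⟨hncr, inst, hr, hρ, hrun', hdom, hmono⟩⟩ := hs.cases
  · simp [hn] at hrun
  rw [hrun] at hrun'
  injection hrun' with hrun'
  subst hrun'
  obtain ⟨R, hR, r, hr⟩ := hPi
  have hcompat := H.compat_self hU hC e.spec.typer
  have hmem : e.ev ∈ e.spec.events := (hβ.history _ _ hrunb).rest e.ev (by simp)
  have hmap : e.ev.map id (RoleTerm.replace c c) = e.ev := by
    rw [RoleTerm.replace_self_eq_id, Event.map_id]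
  obtain ⟨sb', hstep, hK, hsb'⟩ := hs.view (Pi' := {P, Q} ∪ Pi) (rest := rest₀) (g := id)
    (by rw [hrun, hmap]) hrunb hS.knowledge hcompat
    (((H.parts.wellFormed R (.inr hR)).spec r _ hr).typed _ hmem) id (.inl rfl)
  refine ⟨_, sb', hβ.snoc hstep, H.traceSim_push hT (.inl ⟨⟨R, hR, r, hr⟩, hnc, rfl⟩) ?_,
    H.stateSim_update e.inst.rid hS rfl hst ?_ hK hU ⟨fun h => absurd h hC, fun h => absurd h hnc⟩
      (.inl ⟨⟨R, hR, r, hr⟩, hC, ?_⟩)⟩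
  · rintro l r' h _
    exact hncr _ _ h
  · intro y hy _
    rw [hsb']
    exact State.setRun_of_ne _ hy
  · rw [hsb']
    exact State.setRun_self sb
      ⟨e.spec, partInst Q c τ c e.spec.typer e.spec.typer e.inst.rid e.inst, rest₀⟩

theorem step_create_other {R : Protocol S} {rest : List (Event S)}
    (hβ : Reaches K₀ ({P, Q} ∪ Pi) β sb) (hT : TraceSim P Q c d Pi g τ α β)
    (hS : StateSim P Q c d Pi g τ U C st sb) (hU : e.inst.rid ∈ U) (hC : e.inst.rid ∉ C)
    (hnc : ¬ ∃ r, chain g P Q c d r = some e.spec) (hR : R ∈ ({chain g P Q c d} ∪ Pi : Set _))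
    (hinit : IsInitialRun R e.spec e.inst) (hcr : ∃ l r, e.ev = .create l r)
    (hev : e.spec.events = e.ev :: rest) (hn : st.runs e.inst.rid = none)
    (hst : st'.runs = st.setRun ⟨e.spec, e.inst, rest⟩) (hK : st'.knowledge = st.knowledge) :
    ∃ β' sb', Reaches K₀ ({P, Q} ∪ Pi) β' sb' ∧ TraceSim P Q c d Pi g τ (α ++ [e]) β' ∧
      StateSim P Q c d Pi g τ U C st' sb' := by
  obtain ⟨r, hr⟩ := hinit.1
  rcases hR with rfl | hR
  · exact absurd ⟨r, hr⟩ hnc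
  obtain ⟨l, r', hcr⟩ := hcr
  have hcompat := H.compat_self hU hC e.spec.typer
  have hstep : Step ({P, Q} ∪ Pi) sb ⟨e.spec,
      partInst Q c τ c e.spec.typer e.spec.typer e.inst.rid e.inst, e.ev⟩
      ⟨sb.knowledge, sb.setRun ⟨e.spec,
        partInst Q c τ c e.spec.typer e.spec.typer e.inst.rid e.inst, rest⟩⟩ := by
    rw [hcr]
    exact .create (.inr hR) (hinit.view hr (fun _ => .rfl) hcompat) (hev.trans (by rw [hcr]))
      (H.stateSim_unused hS hU hn).1
  refine ⟨_, _, hβ.snoc hstep, H.traceSim_push hT (.inl ⟨⟨R, hR, r, hr⟩, hnc, rfl⟩) ?_,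
    H.stateSim_update e.inst.rid hS rfl hst ?_ (by rw [hK]; exact hS.knowledge) hU
      ⟨fun h => absurd h hC, fun h => absurd h hnc⟩ (.inl ⟨⟨R, hR, r, hr⟩, hC, ?_⟩)⟩
  · rintro l₀ r₀ h
    have := H.label_notMem_right (.inr hR) (fun h => H.right_notMem (h ▸ hR)) hr
      (ev := e.ev) (by simp [hev])
    rwa [show e.ev = _ from h] at this
  · intro y hy _
    exact State.setRun_of_ne _ hy
  · exact State.setRun_self sb
      ⟨e.spec, partInst Q c τ c e.spec.typer e.spec.typer e.inst.rid e.inst, rest⟩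

theorem step_create_chain {R : Protocol S} {rest : List (Event S)}
    (hβ : Reaches K₀ ({P, Q} ∪ Pi) β sb) (hT : TraceSim P Q c d Pi g τ α β)
    (hS : StateSim P Q c d Pi g τ U C st sb) (hU : e.inst.rid ∈ U) (hC : e.inst.rid ∈ C)
    (hc : ∃ r, chain g P Q c d r = some e.spec) (hR : R ∈ ({chain g P Q c d} ∪ Pi : Set _))
    (hinit : IsInitialRun R e.spec e.inst)
    (hev : e.spec.events = e.ev :: rest) (hn : st.runs e.inst.rid = none)
    (hst : st'.runs = st.setRun ⟨e.spec, e.inst, rest⟩) (hK : st'.knowledge = st.knowledge) :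
    ∃ β' sb', Reaches K₀ ({P, Q} ∪ Pi) β' sb' ∧ TraceSim P Q c d Pi g τ (α ++ [e]) β' ∧
      StateSim P Q c d Pi g τ U C st' sb' := by
  obtain ⟨r, hr⟩ := hc
  obtain ⟨r₀, hr₀⟩ := hinit.1
  obtain ⟨rfl, -⟩ := H.whole.spec_unique hR chain_mem_whole hr₀ hr
  obtain ⟨rs₁, rs₂, hP, hQ, hspec⟩ := chain_eq_some.1 hr
  obtain ⟨l, lf, body, hev₁, hev'⟩ := chainSpec_events_of_shape
    ((H.parts.wellFormed P left_mem_parts).spec r rs₁ hP) g c d rs₂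
  rw [← hspec, hev] at hev'
  injection hev' with hcr hrest
  have hcompat : Compat (Nonce.shift Q.idents τ) c c e.spec.typer rs₁.typer e.inst.rid
      e.inst.rid := by
    rw [hspec]; exact H.compat_left rs₂ hP _
  obtain ⟨hn₁, hn₂⟩ := H.stateSim_unused hS hU hn
  have hstep : Step ({P, Q} ∪ Pi) sb ⟨rs₁,
      partInst Q c τ c e.spec.typer rs₁.typer e.inst.rid e.inst, .create l r⟩ _ :=
    .create left_mem_parts (hinit.view hP (chain_isSome H.chainDefined.sameRoles g c d) hcompat) hev₁ hn₁
  refine ⟨_, _, hβ.snoc hstep,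
    H.traceSim_push hT (.inr (.inl ⟨r, ⟨hP, hr, rfl, hcompat⟩, by simp [hev₁], hcr⟩)) ?_,
    H.stateSim_update e.inst.rid hS rfl hst ?_ (by rw [hK]; exact hS.knowledge) hU
      ⟨fun _ => ⟨r, hr⟩, fun _ => hC⟩
      (.inr (.inl ⟨hC, r, rs₁, rs₂, body, hP, hQ, hspec, ⟨lf, ?_⟩, hrest, ?_, ?_⟩))⟩
  · rintro l₀ r₀ h
    have := H.label_notMem_right left_mem_parts (H.left_ne_right hQ) hP
      (ev := .create l r) (by simp [hev₁])
    rwa [show Event.create l r = _ from h] at this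
  · intro y hy _
    exact State.setRun_of_ne _ hy
  · exact State.setRun_self sb ⟨rs₁,
      partInst Q c τ c e.spec.typer rs₁.typer e.inst.rid e.inst, body ++ [.finish lf r]⟩
  · refine (State.setRun_of_ne _ ?_).trans hn₂
    exact fun h => H.move _ hU hC (by rw [h]; exact hU)
  · intro x _
    exact hinit.2.2 x

theorem step (hα : Reaches K₀ ({chain g P Q c d} ∪ Pi) α st)
    (hβ : Reaches K₀ ({P, Q} ∪ Pi) β sb) (hT : TraceSim P Q c d Pi g τ α β)
    (hS : StateSim P Q c d Pi g τ U C st sb) (hs : Step ({chain g P Q c d} ∪ Pi) st e st')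
    (hU : e.inst.rid ∈ U) (hC : e.inst.rid ∈ C ↔ ∃ r, chain g P Q c d r = some e.spec) :
    ∃ β' sb', Reaches K₀ ({P, Q} ∪ Pi) β' sb' ∧ TraceSim P Q c d Pi g τ (α ++ [e]) β' ∧
      StateSim P Q c d Pi g τ U C st' sb' := by
  by_cases hn : st.runs e.inst.rid = none
  · obtain ⟨rest, hst, ⟨R, hR, hinit, ⟨l, r, hcr⟩, hev, -, hK⟩ | ⟨-, inst, -, -, h, -⟩⟩ := hs.cases
    swap
    · simp [hn] at h
    by_cases hCm : e.inst.rid ∈ C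
    · exact H.step_create_chain hβ hT hS hU hCm (hC.1 hCm) hR hinit hev hn hst hK
    · exact H.step_create_other hβ hT hS hU hCm (fun h => hCm (hC.2 h)) hR hinit ⟨l, r, hcr⟩ hev
        hn hst hK
  · obtain ⟨run, hrun⟩ := Option.ne_none_iff_exists'.1 hn
    rcases hS.runs _ _ hrun with ⟨hPi, hCm, h⟩ | ⟨hCm, r, rs₁, rs₂, rest, h⟩ |
      ⟨hCm, r, rs₁, rs₂, rest, h⟩
    · exact H.step_other hβ hT hS hs hU hCm (fun h => hCm (hC.2 h)) hrun hPi h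
    · cases rest with
      | cons ev rest => exact H.step_left hβ hT hS hs hU hCm hrun h
      -- The crossing is postponed until the composed run moves again; only then is its first half
      -- known to be followed by an event of the second.
      | nil =>
        obtain ⟨β', sb', hβ', hT', hS', h'⟩ := H.cross hα hβ hT hS hCm hrun h
        exact H.step_right hβ' hT' hS' hs hU hCm hrun h'
    · exact H.step_right hβ hT hS hs hU hCm hrun h

end Splitting
end SecProt

namespace SecProt

variable {S : Signature.{u}} {K₀ : Set (RunTerm S)} {P Q : Protocol S} {c d : S.Ident}
  {Pi : Set (Protocol S)} {g : S.Label → S.Label} {τ : Equiv.Perm S.RunId} {U C : Set S.RunId}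
  {α β : Trace S} {st sb : State S} {e : RunEvent S} {X : Protocol S} {d' : S.Ident}
  {f : Equiv.Perm S.RunId} {l : S.Label} {r : S.Role} {cl : Claim S} {m : RoleTerm S}

/-! ### Splitting a trace of the composition -/

theorem Splitting.simulate (H : Splitting K₀ P Q c d Pi g τ U C)
    (hα : Reaches K₀ ({chain g P Q c d} ∪ Pi) α st)
    (hU : ∀ e ∈ α, e.inst.rid ∈ U ∧
      (e.inst.rid ∈ C ↔ ∃ r, chain g P Q c d r = some e.spec)) :
    ∃ β sb, Reaches K₀ ({P, Q} ∪ Pi) β sb ∧ TraceSim P Q c d Pi g τ α β ∧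
      StateSim P Q c d Pi g τ U C st sb := by
  induction hα with
  | nil =>
    refine ⟨_, _, .nil, ⟨⟨[], .nil, .refl _⟩, by simp, by simp, by simp⟩, ?_, by simp, by simp,
      by simp⟩
    exact (H.initial.image_rename (Nonce.shift_intruder _ _)).symm
  | snoc hα hs ih =>
    obtain ⟨β, sb, hβ, hT, hS⟩ := ih fun e he => hU e (by simp [he])
    exact H.step hα hβ hT hS hs (hU _ (by simp)).1 (hU _ (by simp)).2

/-- The finite trace is known in advance, so the used and the composed run identifiers are read off
from it and a single `τ` serves all its prefixes. -/
theorem exists_splitting [Infinite S.RunId] (hK₀ : IsInitialKnowledge K₀)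
    (hPQ : ChainDefined K₀ P Q c d) (hP : P ∉ Pi) (hQ : Q ∉ Pi)
    (hPi : IsProtocolSet ({P, Q} ∪ Pi)) (hPi' : IsProtocolSet ({chain g P Q c d} ∪ Pi))
    (hα : Reaches K₀ ({chain g P Q c d} ∪ Pi) α st) :
    ∃ τ U C, Splitting K₀ P Q c d Pi g τ U C ∧ ∃ β sb, Reaches K₀ ({P, Q} ∪ Pi) β sb ∧
      TraceSim P Q c d Pi g τ α β ∧ StateSim P Q c d Pi g τ U C st sb := by
  classical
  let A : Finset S.RunId := (α.map fun e => e.inst.rid).toFinset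
  let B : Finset S.RunId :=
    ((α.filter fun e => ∃ r, chain g P Q c d r = some e.spec).map fun e => e.inst.rid).toFinset
  have hBA : B ⊆ A := by
    intro x hx
    simp only [A, B, List.mem_toFinset, List.mem_map, List.mem_filter] at hx ⊢
    obtain ⟨e, he, rfl⟩ := hx
    exact ⟨e, he.1, rfl⟩
  obtain ⟨τ, h1, h2⟩ := exists_perm_moving A B hBA
  have H : Splitting K₀ P Q c d Pi g τ A B :=
    ⟨hK₀, hPQ, hP, hQ, hPi, hPi', fun rid _ h => h1 rid h, fun rid h h' => h2 rid h h'⟩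
  refine ⟨τ, A, B, H, H.simulate hα fun e he => ⟨?_, ?_⟩⟩
  · simp only [A, Finset.mem_coe, List.mem_toFinset, List.mem_map]
    exact ⟨e, he, rfl⟩
  · simp only [B, Finset.mem_coe, List.mem_toFinset, List.mem_map, List.mem_filter,
      decide_eq_true_eq]
    constructor
    · rintro ⟨e', ⟨he', hc⟩, hr⟩
      rwa [hα.spec_eq he he' hr.symm]
    · intro h
      exact ⟨e, ⟨he, h⟩, rfl⟩

/-- Each creation of a `Q` run is immediately preceded by the end of the `P` run that feeds it, so
the predecessor map is the required injection; truncation at `0` never occurs. -/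
theorem TraceSim.uniqueInput (hT : TraceSim P Q c d Pi g τ α β) :
    UniqueInput {P} {Q} c d β := by
  intro i e _ r _ _ _
  have key : ∀ j ∈ inputPositions {Q} d β e r, ∃ k, j = k + 1 ∧
      k ∈ outputPositions {P} c d β e r := by
    rintro j ⟨e₁, l₁, hj, hev, ⟨_, rfl, hl⟩, hval, hρ⟩
    obtain ⟨k, e₂, l₂, hk, hk₂, hev₂, hl₂, hval₂, hρ₂⟩ := hT.input j e₁ l₁ r hj hev hl
    exact ⟨k, hk, e₂, l₂, hk₂, hev₂, ⟨_, rfl, hl₂⟩, hval₂.trans hval, hρ₂.trans hρ⟩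
  refine ⟨fun j => j - 1, ?_, ?_, ?_⟩
  · intro j hj
    obtain ⟨k, rfl, hk⟩ := key j hj
    exact hk
  · intro j hj j' hj' h
    obtain ⟨k, rfl, -⟩ := key j hj
    obtain ⟨k', rfl, -⟩ := key j' hj'
    simpa using h
  · intro j hj
    obtain ⟨k, rfl, -⟩ := key j hj
    simp

/-! ### Transferring claims -/

/-- `X` is one of the two components; `f` assigns run identifiers to its runs. -/
def IsPart (P Q : Protocol S) (c d : S.Ident) (τ : Equiv.Perm S.RunId) (X : Protocol S)
    (d' : S.Ident) (f : Equiv.Perm S.RunId) : Prop :=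
  (X = P ∧ d' = c ∧ f = 1) ∨ (X = Q ∧ d' = d ∧ f = τ)

theorem IsPart.mem (h : IsPart P Q c d τ X d' f) : X ∈ ({P, Q} ∪ Pi : Set (Protocol S)) := by
  rcases h with ⟨rfl, _⟩ | ⟨rfl, _⟩ <;> simp

theorem IsPart.isSome (h : IsPart P Q c d τ X d' f)
    (hPQ : ∀ r, (P r).isSome ↔ (Q r).isSome) (r : S.Role) :
    (chain g P Q c d r).isSome ↔ (X r).isSome := by
  refine (chain_isSome hPQ g c d r).trans ?_
  rcases h with ⟨rfl, _⟩ | ⟨rfl, _⟩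
  · rfl
  · exact hPQ r

theorem IsPart.traceSim (h : IsPart P Q c d τ X d' f) (hT : TraceSim P Q c d Pi g τ α β) :
    ∀ e' ∈ β, ∀ r, X r = some e'.spec → ∃ e ∈ α, PartRel P Q c d g τ X d' f r e e' := by
  rcases h with ⟨rfl, rfl, rfl⟩ | ⟨rfl, rfl, rfl⟩
  · exact hT.left
  · exact hT.right

theorem IsPart.label_mem_chain (h : IsPart P Q c d τ X d' f)
    (hPQ : ∀ r, (P r).isSome ↔ (Q r).isSome) (hX : X.WellFormed) (hl : IsClaimLabel X cl l) :
    l ∈ X.labels ∧ g l ∈ (chain g P Q c d).labels := by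
  obtain ⟨r, rs, m, hr, hm⟩ := hl
  refine ⟨⟨r, rs, hr, _, hm, rfl⟩, ?_⟩
  obtain ⟨l₁, l₂, body, hev, _⟩ := (hX.spec r rs hr).shape
  have hchain := (h.isSome (g := g) hPQ r).2 (by simp [hr])
  obtain ⟨rs', hrs'⟩ := Option.isSome_iff_exists.1 hchain
  obtain ⟨rs₁, rs₂, hP, hQ, rfl⟩ := chain_eq_some.1 hrs'
  -- A claim is neither the first nor the last event, so it survives the removal of the boundary
  -- events.
  rw [hev] at hm
  simp only [List.mem_cons, List.mem_append, reduceCtorEq, List.not_mem_nil, or_false,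
    false_or] at hm
  have hmem : (Event.claim l r cl (some m)).map g (RoleTerm.replace c d') ∈
      (chainSpec g c d rs₁ rs₂).events := by
    rw [chainSpec_events, List.mem_append]
    rcases h with ⟨rfl, rfl, rfl⟩ | ⟨rfl, rfl, rfl⟩
    · obtain rfl : rs = rs₁ := by simpa [hr] using hP
      refine .inl (List.mem_map_of_mem ?_)
      rw [hev, ← List.cons_append, List.dropLast_concat]
      exact .tail _ hm
    · obtain rfl : rs = rs₂ := by simpa [hr] using hQ
      refine .inr (List.mem_map_of_mem ?_)
      rw [hev]
      simp [hm]
  exact ⟨r, _, hrs', _, hmem, rfl⟩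

theorem PartRel.trusted {e' : RunEvent S} (h : PartRel P Q c d g τ X d' f r e e') :
    e'.Trusted ↔ e.Trusted := by
  unfold RunEvent.Trusted
  rw [h.2.2.1]
  rfl

theorem PartRel.eval {e' : RunEvent S} (h : PartRel P Q c d g τ X d' f r e e') {m : RoleTerm S}
    (hm : ∀ x ∈ m.idents, (e'.spec.typer x).isSome) :
    e'.eval m =
      (e.eval (m.replace c d')).map (RunTerm.rename (Nonce.shift Q.idents τ)) := by
  rw [RunEvent.eval, h.2.2.1]
  exact h.2.2.2.eval_view hm

theorem PartRel.eval_of_eval {e' : RunEvent S} (h : PartRel P Q c d g τ X d' f r e e')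
    {m : RoleTerm S} {t : RunTerm S} (ht : e'.eval m = some t) :
    e.eval (m.replace c d') = some (t.rename (Nonce.shift Q.idents τ).symm) := by
  rw [RunEvent.eval, h.2.2.1] at ht
  exact h.2.2.2.eval_of_eval_view ht

/-- The run event `e'` of the component `X` makes the claim `l` that `e` makes in the
composition. -/
def ClaimRel (P Q : Protocol S) (c d : S.Ident) (g : S.Label → S.Label) (τ : Equiv.Perm S.RunId)
    (X : Protocol S) (d' : S.Ident) (f : Equiv.Perm S.RunId) (l : S.Label) (r : S.Role)
    (cl : Claim S) (m : Option (RoleTerm S)) (e e' : RunEvent S) : Prop :=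
  PartRel P Q c d g τ X d' f r e e' ∧ e'.ev ∈ e'.spec.events ∧
    ∃ m₀, e'.ev = .claim l r cl m₀ ∧ m = m₀.map (RoleTerm.replace c d')

namespace Splitting

variable (H : Splitting K₀ P Q c d Pi g τ U C)
include H

/-- The label `g l` belongs to the composition, which rules out the protocols of `Pi`; injectivity
of `g` recovers `l`, and uniqueness of labels among the parts identifies the component. -/
theorem claimRel (hX : IsPart P Q c d τ X d' f) (hg : Set.InjOn g (P.labels ∪ Q.labels))
    (hl : l ∈ X.labels) (hgl : g l ∈ (chain g P Q c d).labels) {e' : RunEvent S}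
    {m : Option (RoleTerm S)} (hmem : e.ev ∈ e.spec.events)
    (he : EventRel P Q c d Pi g τ e e') (hev : e.ev = .claim (g l) r cl m) :
    ClaimRel P Q c d g τ X d' f l r cl m e e' := by
  have hlPQ : l ∈ P.labels ∪ Q.labels := by
    rcases hX with ⟨rfl, _⟩ | ⟨rfl, _⟩
    · exact .inl hl
    · exact .inr hl
  have key : ∀ (Y : Protocol S) (d₁ : S.Ident) (f₁ : Equiv.Perm S.RunId),
      IsPart P Q c d τ Y d₁ f₁ → ∀ r', PartRel P Q c d g τ Y d₁ f₁ r' e e' →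
      e'.ev ∈ e'.spec.events → e.ev = e'.ev.map g (RoleTerm.replace c d₁) →
      Y = X ∧ ClaimRel P Q c d g τ Y d₁ f₁ l r cl m e e' := by
    intro Y d₁ f₁ hY r' hrel hmem' hmap
    have hlab : e'.ev.label ∈ Y.labels := ⟨r', _, hrel.1, _, hmem', rfl⟩
    have hown := ((H.parts.wellFormed Y hY.mem).spec r' _ hrel.1).owner hmem'
    rw [hev] at hmap
    cases hcl : e'.ev <;> rw [hcl] at hmap hlab hown <;>
      simp only [Event.map, Event.claim.injEq, reduceCtorEq] at hmap
    case claim l₀ r₀ cl₀ m₀ =>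
      obtain ⟨h1, rfl, rfl, rfl⟩ := hmap
      obtain rfl : r = r' := hown
      have hlab' : l₀ ∈ P.labels ∪ Q.labels := by
        rcases hY with ⟨rfl, _⟩ | ⟨rfl, _⟩
        · exact .inl hlab
        · exact .inr hlab
      obtain rfl := hg hlPQ hlab' h1
      exact ⟨H.parts.label_unique Y hY.mem X hX.mem _ hlab hl, hrel, hmem', m₀, hcl, rfl⟩
  rcases he with ⟨⟨R, hR, r', hr'⟩, hnc, -⟩ | ⟨r', h1, h2, h3⟩ | ⟨r', h1, h2, h3⟩
  · have hlR : g l ∈ R.labels := ⟨r', _, hr', _, hmem, by rw [hev]; rfl⟩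
    obtain rfl := H.whole.label_unique R (.inr hR) _ chain_mem_whole _ hlR hgl
    exact absurd ⟨r', hr'⟩ hnc
  · obtain ⟨rfl, h⟩ := key P c 1 (.inl ⟨rfl, rfl, rfl⟩) r' h1 h2 h3
    rcases hX with ⟨_, rfl, rfl⟩ | ⟨h', _⟩
    · exact h
    · obtain ⟨rs₁, rs₂, _, hQ, _⟩ := chain_eq_some.1 h1.2.1
      exact absurd h' (H.left_ne_right hQ)
  · obtain ⟨rfl, h⟩ := key Q d τ (.inr ⟨rfl, rfl, rfl⟩) r' h1 h2 h3
    rcases hX with ⟨h', _⟩ | ⟨_, rfl, rfl⟩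
    · exact absurd h'.symm (H.left_ne_right h1.1)
    · exact h

theorem typed_of_claimRel (hX : IsPart P Q c d τ X d' f) {e' : RunEvent S}
    {m₀ : RoleTerm S} (h : PartRel P Q c d g τ X d' f r e e') (hmem : e'.ev ∈ e'.spec.events)
    (hev : e'.ev = .claim l r cl (some m₀)) : ∀ x ∈ m₀.idents, (e'.spec.typer x).isSome :=
  fun x hx => ((H.parts.wellFormed X hX.mem).spec r _ h.1).typed _ hmem x (by
    rw [hev]; exact ⟨m₀, rfl, hx⟩)

end Splitting
end SecProt

/-! ### Pulling secrecy, uniqueness and data agreement back -/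

namespace SecProt

variable {S : Signature.{u}} {K₀ : Set (RunTerm S)} {P Q : Protocol S} {c d : S.Ident}
  {Pi : Set (Protocol S)} {g : S.Label → S.Label} {τ : Equiv.Perm S.RunId} {U C : Set S.RunId}
  {α β : Trace S} {st sb : State S} {e e' : RunEvent S} {X : Protocol S} {d' : S.Ident}
  {f : Equiv.Perm S.RunId} {l : S.Label} {r : S.Role} {cl : Claim S} {m : RoleTerm S}

theorem TraceSim.exists_index (hT : TraceSim P Q c d Pi g τ α β) :
    ∃ φ : ℕ → ℕ, Function.Injective φ ∧ ∀ i e, α[i]? = some e →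
      ∃ e', β[φ i]? = some e' ∧ EventRel P Q c d Pi g τ e e' := by
  obtain ⟨γ, h1, h2⟩ := hT.matched
  obtain ⟨φ, hφ⟩ := List.sublist_iff_exists_orderEmbedding_getElem?_eq.1 h2
  refine ⟨φ, φ.injective, fun i e hi => ?_⟩
  obtain ⟨hlen, hget⟩ := List.forall₂_iff_get.1 h1
  obtain ⟨hi', rfl⟩ := List.getElem?_eq_some_iff.1 hi
  refine ⟨γ[i], ?_, hget i hi' (hlen ▸ hi')⟩
  rw [← hφ, List.getElem?_eq_getElem]

/-- If the intruder knew the claimed term in the composition, its renamed copy would be known after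
the split trace. -/
theorem StateSim.secret_of_part (hS : StateSim P Q c d Pi g τ U C st sb)
    (hβ : Reaches K₀ ({P, Q} ∪ Pi) β sb) (hrel : PartRel P Q c d g τ X d' f r e e')
    (hm : ∀ x ∈ m.idents, (e'.spec.typer x).isSome)
    (h : secretProp K₀ ({P, Q} ∪ Pi) l r m e' β) {t : RunTerm S}
    (ht : e.eval (m.replace c d') = some t) : t ∉ st.knowledge := by
  intro hmem
  refine h sb hβ _ (by rw [hrel.eval hm, ht]; rfl) ?_
  rw [hS.knowledge]
  exact ⟨t, hmem, rfl⟩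

namespace Splitting

variable (H : Splitting K₀ P Q c d Pi g τ U C)
include H

/-- Two claims on the same value go to two claims on the same renamed value. Their positions
coincide by hypothesis, hence so do the original ones, the position map being injective. -/
theorem sessionUnique_of_part (hα : Reaches K₀ ({chain g P Q c d} ∪ Pi) α st)
    (hT : TraceSim P Q c d Pi g τ α β) (hX : IsPart P Q c d τ X d' f)
    (hg : Set.InjOn g (P.labels ∪ Q.labels)) (hl : l ∈ X.labels)
    (hgl : g l ∈ (chain g P Q c d).labels) (hrel : PartRel P Q c d g τ X d' f r e e')
    (hm : ∀ x ∈ m.idents, (e'.spec.typer x).isSome)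
    (h : sessionUniqueProp ({P, Q} ∪ Pi) l r m e' β) :
    sessionUniqueProp ({chain g P Q c d} ∪ Pi) (g l) r (m.replace c d') e α := by
  intro i j e₁ e₂ cl₁ cl₂ m₁ m₂ t hi hj hev₁ hev₂ ht₁ ht₂ ht
  obtain ⟨φ, hφ, hφ'⟩ := hT.exists_index
  have key : ∀ i e₁ cl₁ m₁, α[i]? = some e₁ → e₁.ev = .claim (g l) r cl₁ m₁ →
      e₁.eval (m.replace c d') = some t → ∃ e₁' m₁', β[φ i]? = some e₁' ∧
      e₁'.ev = .claim l r cl₁ m₁' ∧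
      e₁'.eval m = some (t.rename (Nonce.shift Q.idents τ)) := by
    intro i e₁ cl₁ m₁ hi hev ht
    obtain ⟨e₁', hi', hrel₁⟩ := hφ' i e₁ hi
    obtain ⟨hp, -, m₁', hev', -⟩ := H.claimRel hX hg hl hgl
      (hα.event e₁ (List.mem_of_getElem? hi)).1 hrel₁ hev
    refine ⟨e₁', m₁', hi', hev', ?_⟩
    have hs : e₁'.spec = e'.spec := by
      have := hp.1.symm.trans hrel.1
      injection this
    rw [hp.eval (by rw [hs]; exact hm), ht]
    rfl
  obtain ⟨e₁', m₁', hi', hev₁', ht₁'⟩ := key i e₁ cl₁ m₁ hi hev₁ ht₁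
  obtain ⟨e₂', m₂', hj', hev₂', ht₂'⟩ := key j e₂ cl₂ m₂ hj hev₂ ht₂
  exact hφ (h _ _ e₁' e₂' cl₁ cl₂ m₁' m₂' _ hi' hj' hev₁' hev₂' ht₁' ht₂'
    (by rw [hrel.eval hm, ht]; rfl))

/-- The witnessing events of `β` may be inserted boundary events without a counterpart in `α`. It
suffices that some event of the composed run has the corresponding instantiation, since agreement
asks only for an event of that run; the composed create event is then found in the history of the
run. -/
theorem dataAgree_of_part (hα : Reaches K₀ ({chain g P Q c d} ∪ Pi) α st)
    (hβ : Reaches K₀ ({P, Q} ∪ Pi) β sb) (hT : TraceSim P Q c d Pi g τ α β)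
    (hX : IsPart P Q c d τ X d' f) (hl : l ∈ X.labels)
    (hgl : g l ∈ (chain g P Q c d).labels) (hrel : PartRel P Q c d g τ X d' f r e e')
    (h : dataAgreeProp ({P, Q} ∪ Pi) l r m e' β) :
    dataAgreeProp ({chain g P Q c d} ∪ Pi) (g l) r (m.replace c d') e α := by
  obtain ⟨Y, hY, hlY, κ, ⟨ρ, hρ⟩, hagree⟩ := h
  obtain rfl := H.parts.label_unique Y hY X hX.mem l hlY hl
  have hsome := hX.isSome (g := g) H.chainDefined.sameRoles
  have hcreate : ∀ r', (Y r').isSome → ∃ e₁ ∈ β, Y r' = some e₁.spec ∧ e₁.inst.rid = κ r' ∧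
      e₁.inst.roles = ρ := by
    intro r' hr'
    obtain ⟨e₁, he₁, l₁, hl₁, hev₁, hrid, hroles⟩ := hρ r' hr'
    refine ⟨e₁, he₁, ?_, hrid, hroles⟩
    obtain ⟨hmem, run, hrun, hspec, -⟩ := hβ.event e₁ he₁
    obtain ⟨R, hR, ⟨r₁, hr₁⟩, -⟩ := (hβ.history _ _ hrun).spec
    rw [hspec] at hr₁
    obtain rfl := H.parts.label_unique R hR Y hY l₁
      ⟨r₁, _, hr₁, _, hmem, by rw [hev₁]; rfl⟩ hl₁
    have hown := ((H.parts.wellFormed R hR).spec r₁ _ hr₁).owner hmem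
    rw [hev₁] at hown
    obtain rfl : r' = r₁ := hown
    exact hr₁
  -- A composed run `rid` has the identifier `f rid` in the component, so the cast is pulled back by
  -- `f⁻¹`.
  refine ⟨_, chain_mem_whole, hgl, fun r' => f.symm (κ r'), ⟨ρ, fun r' hr' => ?_⟩,
    fun r' hr' => ?_⟩
  · obtain ⟨e₁, he₁, hs₁, hrid₁, hρ₁⟩ := hcreate r' ((hsome r').1 hr')
    obtain ⟨e₂, he₂, hrel₂⟩ := hX.traceSim hT e₁ he₁ r' hs₁
    obtain ⟨-, run, hrun, hspec, hroles⟩ := hα.event e₂ he₂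
    obtain ⟨e₀, he₀, hs₀, hrid₀, hρ₀, ⟨l₀, r₀, hev₀⟩, hmem₀⟩ := (hα.history _ _ hrun).first
    have hch : chain g P Q c d r' = some run.spec := by rw [hspec]; exact hrel₂.2.1
    have hown := ((H.whole.wellFormed _ chain_mem_whole).spec r' _ hch).owner hmem₀
    rw [hev₀] at hown hmem₀
    obtain rfl : r₀ = r' := hown
    refine ⟨e₀, he₀, l₀, ⟨r₀, _, hch, _, hmem₀, rfl⟩, hev₀, ?_, ?_⟩
    · change _ = f.symm (κ _)
      rw [hrid₀, ← hrid₁, hrel₂.2.2.1]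
      exact (f.symm_apply_apply _).symm
    · rw [hρ₀, hroles, ← hρ₁, hrel₂.2.2.1]
      rfl
  · obtain ⟨e₁, he₁, hs₁, hrid₁, -⟩ := hcreate r' ((hsome r').1 hr')
    obtain ⟨e₂, he₂, hrid₂, t, ht₂, ht⟩ := hagree r' ((hsome r').1 hr')
    rw [hβ.spec_eq he₁ he₂ (hrid₁.trans hrid₂.symm)] at hs₁
    obtain ⟨e₃, he₃, hrel₃⟩ := hX.traceSim hT e₂ he₂ r' hs₁
    refine ⟨e₃, he₃, ?_, _, hrel₃.eval_of_eval ht₂, hrel.eval_of_eval ht⟩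
    change _ = f.symm (κ _)
    rw [← hrid₂, hrel₃.2.2.1]
    exact (f.symm_apply_apply _).symm

end Splitting

/-- A claim of the composition is transferred to the corresponding claim of a component. -/
theorem exists_part_claim [Infinite S.RunId] (hK₀ : IsInitialKnowledge K₀)
    (hPQ : ChainDefined K₀ P Q c d) (hP : P ∉ Pi) (hQ : Q ∉ Pi)
    (hPi : IsProtocolSet ({P, Q} ∪ Pi)) (hg : Set.InjOn g (P.labels ∪ Q.labels))
    (hPi' : IsProtocolSet ({chain g P Q c d} ∪ Pi)) {cl₀ : Claim S}
    (hl : IsClaimLabel P cl₀ l ∨ IsClaimLabel Q cl₀ l) {F : SecurityProperty S}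
    (hsat : Satisfies K₀ ({P, Q} ∪ Pi) (UniqueInput {P} {Q} c d) F l)
    (hα : Reaches K₀ ({chain g P Q c d} ∪ Pi) α st) (he : e ∈ α)
    (hev : e.ev = .claim (g l) r cl (some m)) (htr : e.Trusted) :
    ∃ τ U C X d' f β sb e' m₀, Splitting K₀ P Q c d Pi g τ U C ∧ IsPart P Q c d τ X d' f ∧
      Reaches K₀ ({P, Q} ∪ Pi) β sb ∧ TraceSim P Q c d Pi g τ α β ∧
      StateSim P Q c d Pi g τ U C st sb ∧ l ∈ X.labels ∧ g l ∈ (chain g P Q c d).labels ∧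
      PartRel P Q c d g τ X d' f r e e' ∧ m = m₀.replace c d' ∧
      (∀ x ∈ m₀.idents, (e'.spec.typer x).isSome) ∧ F ({P, Q} ∪ Pi) l r m₀ e' β := by
  obtain ⟨τ, U, C, H, β, sb, hβ, hT, hS⟩ := exists_splitting hK₀ hPQ hP hQ hPi hPi' hα
  obtain ⟨X, d', f, hX, hlX⟩ : ∃ X d' f, IsPart P Q c d τ X d' f ∧ IsClaimLabel X cl₀ l := by
    rcases hl with h | h
    · exact ⟨P, c, 1, .inl ⟨rfl, rfl, rfl⟩, h⟩
    · exact ⟨Q, d, τ, .inr ⟨rfl, rfl, rfl⟩, h⟩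
  obtain ⟨hl, hgl⟩ := hX.label_mem_chain (g := g) hPQ.sameRoles (hPi.wellFormed X hX.mem) hlX
  obtain ⟨φ, -, hφ⟩ := hT.exists_index
  obtain ⟨i, hi⟩ := List.mem_iff_getElem?.1 he
  obtain ⟨e', hi', hrel⟩ := hφ i e hi
  obtain ⟨hp, hmem, m₀, hev', hm⟩ := H.claimRel hX hg hl hgl (hα.event e he).1 hrel hev
  cases m₀ with
  | none => simp at hm
  | some m₀ =>
    simp only [Option.map_some, Option.some.injEq] at hm
    refine ⟨τ, U, C, X, d', f, β, sb, e', m₀, H, hX, hβ, hT, hS, hl, hgl, hp, hm,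
      H.typed_of_claimRel hX hp hmem hev', ?_⟩
    exact (hsat β ⟨sb, hβ⟩ hT.uniqueInput e' (List.mem_of_getElem? hi') r cl m₀ hev').resolve_right
      (not_not.2 (hp.trusted.2 htr))

end SecProt

theorem mainTheorem9 {S : SecProt.Signature.{u}} [Infinite S.RunId]
    (K₀ : Set (SecProt.RunTerm S)) (hK₀ : SecProt.IsInitialKnowledge K₀)
    (P Q : SecProt.Protocol S) (c d : S.Ident) (hPQ : SecProt.ChainDefined K₀ P Q c d)
    (Pi : Set (SecProt.Protocol S)) (hP : P ∉ Pi) (hQ : Q ∉ Pi)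
    (hPi : SecProt.IsProtocolSet ({P, Q} ∪ Pi))
    (g : S.Label → S.Label) (hg : Set.InjOn g (P.labels ∪ Q.labels))
    (hPi' : SecProt.IsProtocolSet ({SecProt.chain g P Q c d} ∪ Pi)) (l : S.Label) :
    ((SecProt.IsClaimLabel P .session l ∨ SecProt.IsClaimLabel Q .session l) →
      SecProt.Satisfies K₀ ({P, Q} ∪ Pi) (SecProt.UniqueInput {P} {Q} c d)
        (SecProt.sessionProp K₀) l →
      SecProt.Satisfies K₀ ({SecProt.chain g P Q c d} ∪ Pi) (fun _ => True)
        (SecProt.sessionProp K₀) (g l)) ∧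
    ((SecProt.IsClaimLabel P .weakSession l ∨ SecProt.IsClaimLabel Q .weakSession l) →
      SecProt.Satisfies K₀ ({P, Q} ∪ Pi) (SecProt.UniqueInput {P} {Q} c d)
        (SecProt.weakSessionProp K₀) l →
      SecProt.Satisfies K₀ ({SecProt.chain g P Q c d} ∪ Pi) (fun _ => True)
        (SecProt.weakSessionProp K₀) (g l)) := by
  constructor
  · intro hl hsat α hα _ e he r cl m hev
    refine or_iff_not_imp_right.2 fun htr => ⟨?_, ?_⟩
    -- Secrecy concerns an arbitrary state reached by `α`, so the splitting is made for that
    -- derivation; the other properties use any one derivation.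
    · intro st hst t ht
      obtain ⟨τ, U, C, X, d', f, β, sb, e', m₀, H, hX, hβ, hT, hS, hlX, hgl, hp, rfl, hm, hF⟩ :=
        SecProt.exists_part_claim hK₀ hPQ hP hQ hPi hg hPi' hl hsat hst he hev (not_not.1 htr)
      exact hS.secret_of_part hβ hp hm hF.1 ht
    · obtain ⟨st, hst⟩ := hα
      obtain ⟨τ, U, C, X, d', f, β, sb, e', m₀, H, hX, hβ, hT, hS, hlX, hgl, hp, rfl, hm, hF⟩ :=
        SecProt.exists_part_claim hK₀ hPQ hP hQ hPi hg hPi' hl hsat hst he hev (not_not.1 htr)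
      exact ⟨H.sessionUnique_of_part hst hT hX hg hlX hgl hp hm hF.2.1,
        H.dataAgree_of_part hst hβ hT hX hlX hgl hp hF.2.2⟩
  · intro hl hsat α hα _ e he r cl m hev
    refine or_iff_not_imp_right.2 fun htr => ⟨?_, ?_⟩
    · intro st hst t ht
      obtain ⟨τ, U, C, X, d', f, β, sb, e', m₀, H, hX, hβ, hT, hS, hlX, hgl, hp, rfl, hm, hF⟩ :=
        SecProt.exists_part_claim hK₀ hPQ hP hQ hPi hg hPi' hl hsat hst he hev (not_not.1 htr)
      exact hS.secret_of_part hβ hp hm hF.1 ht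
    · obtain ⟨st, hst⟩ := hα
      obtain ⟨τ, U, C, X, d', f, β, sb, e', m₀, H, hX, hβ, hT, hS, hlX, hgl, hp, rfl, hm, hF⟩ :=
        SecProt.exists_part_claim hK₀ hPQ hP hQ hPi hg hPi' hl hsat hst he hev (not_not.1 htr)
      exact H.sessionUnique_of_part hst hT hX hg hlX hgl hp hm hF.2
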